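/- **Theorem 1.2 (Exponential off-diagonal localization for general interaction cost).** There is a universal constant $K>0$ such that the following holds. Let $N\ge 2$, $\varepsilon>0$, and let $c:\mathbb R^3\times\mathbb R^3\to[0,+\infty]$ be a (measurable) pair cost with $$m(|x-y|)\le c(x,y)\le M(|x-y|)\qquad\text{for all } x\ne y,$$ where $m,M:(0,\infty)\to[0,\infty)$ are decreasing (in the weak sense) and $\lim_{t\to0^+}m(t)=+\infty$. Put $v_{ee}(x_1,\dots,x_N)=\sum_{i<j}c(x_i,x_j)$. Let $\rho$ be a measure on $\mathbb R^3$ with $\rho(\mathbb R^3)=N$, and let $\psi_\varepsilon$ minimize, with finite value, $$\psi\longmapsto\int_{\mathbb R^{3N}}\varepsilon|\nabla\psi|^2+v_{ee}|\psi|^2\,dx$$ among all bosonic (i.e. permutation-symmetric) $\psi\in H^1(\mathbb R^{3N};\mathbb C)$ with one-body density $\rho$, i.e. such that $N$ times each one-particle marginal of $|\psi|^2dx$ is $\rho$. Write $$\kappa(\rho,r)=\sup_{x\in\mathbb R^3}\frac{\rho(B(x,r))}{N},\qquad D_\alpha=\{x\in(\mathbb R^3)^N:\ |x_i-x_j|\le\alpha\text{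 for some } i\ne j\}.$$ Let $\beta>0$ satisfy $\kappa(\rho,\beta)\le\frac1{4(N-1)}$, and let $\alpha>0$ satisfy $$m(2\alpha)\ge 8(N-1)\,M(\beta/2)\qquad\text{and}\qquad K\,\varepsilon N^2\le\alpha^2m(2\alpha).$$ Then $$\int_{D_\alpha}|\psi_\varepsilon(x)|^2\,dx\le\exp\left(-\frac16\sqrt{\frac{\alpha^2m(2\alpha)}{8\varepsilon}}\right).$$ -/

import Mathlib

open MeasureTheory Set Filter Topology
open scoped ENNReal ContDiff

namespace LevyLieb

/-- Physical space `ℝ³`, with its Euclidean norm. -/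
abbrev Space : Type := EuclideanSpace ℝ (Fin 3)

/-- The configuration space `ℝ^{3N} = (ℝ³)^N` of `N` particles. Its `volume` is Lebesgue measure;
the norm of this type is never used to measure lengths. -/
abbrev Config (N : ℕ) : Type := Fin N → Space

/-- The coordinate vector of `ℝ^{3N}` for the `k`-th coordinate of the `i`-th particle. -/
noncomputable def coordVec {N : ℕ} (i : Fin N) (k : Fin 3) : Config N :=
  Pi.single i (EuclideanSpace.single k (1 : ℝ))

/-- `g` is a weak (distributional) partial derivative of `ψ` with respect to the `k`-th coordinate
of the `i`-th particle: `∫ (∂φ) ψ = - ∫ φ g` for all `φ ∈ C_c^∞(ℝ^{3N})`. -/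
def HasWeakPartial {N : ℕ} (ψ g : Config N → ℂ) (i : Fin N) (k : Fin 3) : Prop :=
  LocallyIntegrable ψ ∧ LocallyIntegrable g ∧
    ∀ φ : Config N → ℝ, ContDiff ℝ ∞ φ → HasCompactSupport φ →
      ∫ x, fderiv ℝ φ x (coordVec i k) • ψ x = -∫ x, φ x • g x

/-- The Sobolev space `H¹(ℝ^{3N}; ℂ)`. -/
def MemH1 {N : ℕ} (ψ : Config N → ℂ) : Prop :=
  MemLp ψ 2 ∧ ∀ (i : Fin N) (k : Fin 3), ∃ g, MemLp g 2 ∧ HasWeakPartial ψ g i k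

open Classical in
/-- The weak partial derivative, which is unique almost everywhere (and `0` if there is none). -/
noncomputable def weakPartial {N : ℕ} (ψ : Config N → ℂ) (i : Fin N) (k : Fin 3) :
    Config N → ℂ :=
  if h : ∃ g, HasWeakPartial ψ g i k then h.choose else 0

/-- `|∇ψ|²` integrated over `ℝ^{3N}`. -/
noncomputable def kineticEnergy {N : ℕ} (ψ : Config N → ℂ) : ℝ≥0∞ :=
  ∫⁻ x, ∑ i : Fin N, ∑ k : Fin 3, ‖weakPartial ψ i k x‖ₑ ^ 2

/-- The pair interaction `v_ee(x₁, …, x_N) = ∑_{i < j} c(x_i, x_j)`. -/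
noncomputable def pairInteraction {N : ℕ} (c : Space → Space → ℝ≥0∞) (x : Config N) : ℝ≥0∞ :=
  ∑ i : Fin N, ∑ j ∈ Finset.Ioi i, c (x i) (x j)

/-- The energy `∫ ε |∇ψ|² + v_ee |ψ|²`. -/
noncomputable def energy {N : ℕ} (ε : ℝ) (c : Space → Space → ℝ≥0∞) (ψ : Config N → ℂ) : ℝ≥0∞ :=
  ENNReal.ofReal ε * kineticEnergy ψ + ∫⁻ x, pairInteraction c x * ‖ψ x‖ₑ ^ 2

/-- Bosonic symmetry: `ψ` is invariant under permutations of the particles. -/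
def IsBosonic {N : ℕ} (ψ : Config N → ℂ) : Prop :=
  ∀ σ : Equiv.Perm (Fin N), (fun x : Config N => ψ (fun i => x (σ i))) =ᵐ[volume] ψ

/-- The position distribution `|ψ|² dx` on `ℝ^{3N}`. -/
noncomputable def positionMeasure {N : ℕ} (ψ : Config N → ℂ) : Measure (Config N) :=
  volume.withDensity (fun x => ‖ψ x‖ₑ ^ 2)

/-- `ψ ↦ ρ`: the one-body density of `ψ` is `ρ`, that is, `ρ` is `N` times each one-particle
marginal of `|ψ|² dx`. -/
def HasDensity {N : ℕ} (ψ : Config N → ℂ) (ρ : Measure Space) : Prop :=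
  ∀ i : Fin N, (N : ℝ≥0∞) • (positionMeasure ψ).map (fun x => x i) = ρ

/-- The bosonic wave functions in `H¹` with one-body density `ρ`. -/
def IsAdmissible {N : ℕ} (ρ : Measure Space) (ψ : Config N → ℂ) : Prop :=
  MemH1 ψ ∧ IsBosonic ψ ∧ HasDensity ψ ρ

/-- `ψ` attains the (finite) minimum that defines the bosonic Levy-Lieb functional at `ρ`. -/
def IsMinimizer {N : ℕ} (ε : ℝ) (c : Space → Space → ℝ≥0∞) (ρ : Measure Space)
    (ψ : Config N → ℂ) : Prop :=
  IsAdmissible ρ ψ ∧ energy ε c ψ ≠ ⊤ ∧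
    ∀ φ : Config N → ℂ, IsAdmissible ρ φ → energy ε c ψ ≤ energy ε c φ

/-- `c` is a repulsive pair cost with `m(|x - y|) ≤ c(x, y) ≤ M(|x - y|)`, where
`m, M : (0, ∞) → [0, ∞)` are decreasing and `m(t) → ∞` as `t → 0⁺`. Since `m` and `M` live on
`(0, ∞)`, nothing is asked on the diagonal, where `c` may take any value, `∞` included. -/
structure IsRepulsiveCost (c : Space → Space → ℝ≥0∞) (m M : ℝ → ℝ) : Prop where
  measurable : Measurable (fun p : Space × Space => c p.1 p.2)
  lower_nonneg : ∀ t, 0 < t → 0 ≤ m t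
  upper_nonneg : ∀ t, 0 < t → 0 ≤ M t
  lower_antitone : AntitoneOn m (Ioi 0)
  upper_antitone : AntitoneOn M (Ioi 0)
  lower_tendsto : Tendsto m (𝓝[>] 0) atTop
  lower_le : ∀ x y, x ≠ y → ENNReal.ofReal (m ‖x - y‖) ≤ c x y
  le_upper : ∀ x y, x ≠ y → c x y ≤ ENNReal.ofReal (M ‖x - y‖)

/-- The concentration `κ(ρ, r) = sup_x ρ(B(x, r)) / N`. -/
noncomputable def concentration (N : ℕ) (ρ : Measure Space) (r : ℝ) : ℝ≥0∞ :=
  ⨆ x : Space, ρ (Metric.ball x r) / N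

/-- The enlarged diagonal `D_δ`: some two distinct particles are at distance at most `δ`. -/
def enlargedDiagonal (N : ℕ) (δ : ℝ) : Set (Config N) :=
  {x | ∃ i j : Fin N, i ≠ j ∧ ‖x i - x j‖ ≤ δ}

end LevyLieb

/-!
# Exponential off-diagonal localization

The minimizer `ψ` is compared with a competitor of the same one-body density in which close pairs
of particles are separated. Two independent copies of the system, in the state `ψ ⊗ ψ`, are drawn,
a part of this state is selected by an amplitude `b (x, y)`, and there the particle `i` of the
first copy is exchanged with the particle `i` of the second one (`exchange`). An exchange only
moves particles between the copies, so the one-body density is unchanged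
(`lintegral_indicator_mul_exchangeDensity`). The competitor is the square root of the first
marginal of the resulting density on pairs, averaged over the permutations of the particles
(`exchangeState`, `symmetrize`).

The amplitude is a multiple of `η(x) χ(x, y)`. Here `η(x) = exp (κ (2α - |x_i - x_k|)⁺) - 1` is
supported where the particles `i` and `k` are close (`closeWeight`), and `χ` is a cutoff to the
exchanges that bring both particles far from their new neighbours (`separation`). Selected pairs
lose at least `m(2α)` of interaction energy and gain at most `2 (N - 1) M(β/2)`
(`symInteraction_exchange_le`), and since `ρ` is not concentrated, `χ` keeps at least half of the
pairs (`half_le_lintegral_separation`).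

The kinetic energy is controlled through translations: a function is in `H¹` if and only if its
translates are Lipschitz in `L²` (`MemH1.lintegral_translate_le`, `memH1_of_translate`). This
criterion passes to square roots of marginals by the triangle inequality in `L²`. Since the three
parts of the doubled system (what is left, and the exchanged part in both orderings) are `ψ ⊗ ψ`
times the components of a unit vector, the localization formula `sq_sub_unit_le` shows that the
kinetic energy grows at most by the contribution of the gradients of `η` and `χ`
(`lintegral_exchangeState_translate_le`).

Minimality therefore bounds `m(2α) ∫ η² |ψ|²` by a multiple of
`ε κ² ∫ (η + 1)² |ψ|² + ε N α⁻² ∫ η² |ψ|²`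
(`IsMinimizer.exchange_le`). For `κ² = m(2α) / (512 ε)` the right-hand side can be absorbed, which
gives `∫ η² |ψ|² ≤ 1` (`IsMinimizer.closeMass_le_one`); by Chebyshev's inequality the event
`|x_i - x_k| ≤ α` has probability at most `4 exp (-2 κ α)`. The union bound over the pairs costs
a factor `N²`, which is absorbed by passing to the smaller rate in the claim, as the rate is
large compared with `N` by the choice of `K`.
-/

/-! ### Square norms as lower Lebesgue integrals -/

theorem MeasureTheory.eLpNorm_two_sq_eq_lintegral {Ω F : Type*} [MeasurableSpace Ω]
    {μ : Measure Ω} [NormedAddCommGroup F] (f : Ω → F) :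
    eLpNorm f 2 μ ^ 2 = ∫⁻ x, ‖f x‖ₑ ^ 2 ∂μ := by
  rw [eLpNorm_eq_lintegral_rpow_enorm_toReal (by norm_num) (by norm_num)]
  rw [← ENNReal.rpow_natCast, ← ENNReal.rpow_mul]
  norm_num

theorem MeasureTheory.memLp_two_iff_lintegral_sq {Ω F : Type*} [MeasurableSpace Ω]
    {μ : Measure Ω} [NormedAddCommGroup F] {f : Ω → F} (hf : AEStronglyMeasurable f μ) :
    MemLp f 2 μ ↔ ∫⁻ x, ‖f x‖ₑ ^ 2 ∂μ ≠ ⊤ := by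
  rw [← eLpNorm_two_sq_eq_lintegral, MemLp]
  simp [hf, lt_top_iff_ne_top]

/-- The Cauchy-Schwarz inequality in `L²`. -/
theorem MeasureTheory.abs_integral_mul_le_eLpNorm_two {Ω : Type*} [MeasurableSpace Ω]
    {μ : Measure Ω} {f g : Ω → ℝ} (hf : MemLp f 2 μ) (hg : MemLp g 2 μ) :
    |∫ x, f x * g x ∂μ| ≤ (eLpNorm f 2 μ).toReal * (eLpNorm g 2 μ).toReal := by
  have h1 : ∫ x, f x * g x ∂μ = inner ℝ (hf.toLp f) (hg.toLp g) := by
    rw [L2.inner_def]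
    refine integral_congr_ae ?_
    filter_upwards [hf.coeFn_toLp, hg.coeFn_toLp] with x h1 h2
    simp [h1, h2, mul_comm]
  rw [h1]
  refine (abs_real_inner_le_norm _ _).trans ?_
  rw [Lp.norm_toLp, Lp.norm_toLp]

/-! ### Representation of bounded functionals on test functions -/

/-- A functional `ℓ` that is bounded with respect to the seminorm `‖J ·‖` pulled back from a
Hilbert space is represented by a vector of that space. -/
theorem exists_inner_eq_of_abs_le {S H : Type*} [AddCommGroup S] [Module ℝ S]
    [NormedAddCommGroup H] [InnerProductSpace ℝ H] [CompleteSpace H]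
    (J : S →ₗ[ℝ] H) (l : S →ₗ[ℝ] ℝ) {C : ℝ} (hC : 0 ≤ C) (h : ∀ s, |l s| ≤ C * ‖J s‖) :
    ∃ g : H, ‖g‖ ≤ C ∧ ∀ s, l s = inner ℝ g (J s) := by
  have hker : LinearMap.ker J ≤ LinearMap.ker l := by
    intro s hs
    have h1 := h s
    rw [LinearMap.mem_ker] at hs ⊢
    rw [hs, norm_zero, mul_zero] at h1
    exact abs_nonpos_iff.1 h1
  let l' : LinearMap.range J →ₗ[ℝ] ℝ :=
    ((LinearMap.ker J).liftQ l hker).comp J.quotKerEquivRange.symm.toLinearMap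
  have hl' : ∀ s, l' ⟨J s, LinearMap.mem_range_self J s⟩ = l s := by
    intro s
    have : J.quotKerEquivRange.symm ⟨J s, LinearMap.mem_range_self J s⟩
        = (LinearMap.ker J).mkQ s := by
      rw [LinearEquiv.symm_apply_eq]
      rfl
    simp only [l', LinearMap.comp_apply, LinearEquiv.coe_coe, this]
    simp
  let L : StrongDual ℝ (LinearMap.range J) := l'.mkContinuous C (by
    rintro ⟨_, s, rfl⟩
    rw [hl']
    exact h s)
  obtain ⟨G, hG, hGn⟩ := exists_extension_norm_eq (LinearMap.range J) L
  refine ⟨(InnerProductSpace.toDual ℝ H).symm G, ?_, fun s => ?_⟩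
  · rw [LinearIsometryEquiv.norm_map, hGn]
    exact LinearMap.mkContinuous_norm_le _ hC _
  · rw [InnerProductSpace.toDual_symm_apply]
    have := hG ⟨J s, LinearMap.mem_range_self J s⟩
    rw [this]
    exact (hl' s).symm

section Sobolev

set_option linter.unusedSectionVars false

variable {E : Type*} [NormedAddCommGroup E] [NormedSpace ℝ E]

/-- The smooth compactly supported functions on `E`. -/
def testFunctions (E : Type*) [NormedAddCommGroup E] [NormedSpace ℝ E] :
    Submodule ℝ (E → ℝ) where
  carrier := {φ | ContDiff ℝ ∞ φ ∧ HasCompactSupport φ}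
  add_mem' hf hg := ⟨hf.1.add hg.1, hf.2.add hg.2⟩
  zero_mem' := ⟨contDiff_const, HasCompactSupport.zero⟩
  smul_mem' _ _ hf := ⟨contDiff_const.smul hf.1, hf.2.smul_left⟩

variable [FiniteDimensional ℝ E] [MeasurableSpace E] [BorelSpace E]
  {μ : Measure E} [μ.IsAddHaarMeasure]

theorem testFunctions.memLp (φ : testFunctions E) : MemLp (φ : E → ℝ) 2 μ :=
  φ.2.1.continuous.memLp_of_hasCompactSupport φ.2.2

/-- A linear functional on test functions that is bounded in the `L²` norm is given by
integration against an `L²` function. -/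
theorem exists_memLp_of_abs_le (l : testFunctions E →ₗ[ℝ] ℝ) {C : ℝ} (hC : 0 ≤ C)
    (h : ∀ φ, |l φ| ≤ C * (eLpNorm (φ : E → ℝ) 2 μ).toReal) :
    ∃ g : E → ℝ, MemLp g 2 μ ∧ eLpNorm g 2 μ ≤ ENNReal.ofReal C ∧
      ∀ φ : testFunctions E, l φ = ∫ x, (φ : E → ℝ) x * g x ∂μ := by
  let J : testFunctions E →ₗ[ℝ] Lp ℝ 2 μ :=
    { toFun := fun φ => (testFunctions.memLp φ).toLp _
      map_add' := fun φ χ => MemLp.toLp_add (testFunctions.memLp φ) (testFunctions.memLp χ)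
      map_smul' := fun c φ => MemLp.toLp_const_smul c (testFunctions.memLp φ) }
  obtain ⟨g, hg, hl⟩ := exists_inner_eq_of_abs_le J l hC (fun φ => by
    simpa [J, Lp.norm_toLp] using h φ)
  refine ⟨g, Lp.memLp g, ?_, fun φ => ?_⟩
  · rw [Lp.norm_def] at hg
    exact (ENNReal.le_ofReal_iff_toReal_le (Lp.eLpNorm_ne_top g) hC).2 hg
  · rw [hl, L2.inner_def]
    refine integral_congr_ae ?_
    filter_upwards [(testFunctions.memLp (μ := μ) φ).coeFn_toLp] with x hx
    simp [J, hx]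

/-- Differentiation under the integral sign for the translates of a test function. -/
theorem hasDerivAt_integral_translate {f : E → ℝ} (hf : LocallyIntegrable f μ)
    (φ : testFunctions E) (v : E) :
    HasDerivAt (fun t : ℝ => ∫ x, (φ : E → ℝ) (x + t • v) * f x ∂μ)
      (∫ x, fderiv ℝ (φ : E → ℝ) x v * f x ∂μ) 0 := by
  obtain ⟨φ, hφ, hc⟩ := φ
  simp only
  have hdc : Continuous (fun x => fderiv ℝ φ x v) :=
    (hφ.continuous_fderiv (by simp)).clm_apply continuous_const
  have hds : HasCompactSupport (fun x => fderiv ℝ φ x v) := hc.fderiv_apply (𝕜 := ℝ) v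
  obtain ⟨C, hC⟩ := hdc.bounded_above_of_compact_support hds
  let K := Metric.cthickening ‖v‖ (tsupport (fun x => fderiv ℝ φ x v))
  have hK : IsCompact K := hds.isCompact.cthickening
  have hKm : MeasurableSet K := hK.isClosed.measurableSet
  have hfs := hf.aestronglyMeasurable
  have key := hasDerivAt_integral_of_dominated_loc_of_deriv_le (μ := μ) (𝕜 := ℝ)
    (F := fun t x => φ (x + t • v) * f x) (F' := fun t x => fderiv ℝ φ (x + t • v) v * f x)
    (x₀ := (0 : ℝ)) (s := Metric.ball 0 1) (bound := K.indicator (fun x => C * ‖f x‖))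
    (Metric.ball_mem_nhds _ one_pos) ?_ ?_ ?_ ?_ ?_ ?_
  · simpa using key.2
  · refine Eventually.of_forall fun t => ?_
    have hc' : Continuous fun x : E => φ (x + t • v) := hφ.continuous.comp (by fun_prop)
    exact hc'.aestronglyMeasurable.mul hfs
  · simpa using hf.integrable_smul_left_of_hasCompactSupport hφ.continuous hc
  · have h0 : AEStronglyMeasurable (fun x => fderiv ℝ φ x v * f x) μ :=
      hdc.aestronglyMeasurable.mul hfs
    simpa using h0
  · refine Eventually.of_forall fun x t ht => ?_
    by_cases hx : x ∈ K
    · rw [indicator_of_mem hx, norm_mul]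
      exact mul_le_mul_of_nonneg_right (hC _) (norm_nonneg _)
    · rw [indicator_of_notMem hx]
      have : x + t • v ∉ tsupport (fun x => fderiv ℝ φ x v) := by
        intro h
        apply hx
        refine Metric.mem_cthickening_of_dist_le x _ _ _ h ?_
        rw [dist_eq_norm]
        simp only [Metric.mem_ball, dist_zero_right, Real.norm_eq_abs] at ht
        simp only [sub_add_cancel_left, norm_neg, norm_smul, Real.norm_eq_abs]
        exact mul_le_of_le_one_left (norm_nonneg _) ht.le
      have h0 := image_eq_zero_of_notMem_tsupport this
      simp [h0]
  · rw [integrable_indicator_iff hKm]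
    exact ((hf.integrableOn_isCompact hK).norm.const_mul C)
  · refine Eventually.of_forall fun x t _ => ?_
    have h1 : HasDerivAt (fun t : ℝ => x + t • v) v t := by
      simpa using ((hasDerivAt_id t).smul_const v).const_add x
    have h2 := (hφ.differentiable (by simp) (x + t • v)).hasFDerivAt.comp_hasDerivAt t h1
    exact h2.mul_const (f x)

/-- The translate of a test function. -/
def testFunctions.translate (φ : testFunctions E) (w : E) : testFunctions E :=
  ⟨fun x => (φ : E → ℝ) (x + w), φ.2.1.comp (contDiff_id.add contDiff_const),
    φ.2.2.comp_homeomorph (Homeomorph.addRight w)⟩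

theorem testFunctions.integral_translate_mul (φ : testFunctions E) (w : E) (f : E → ℝ) :
    ∫ x, (φ : E → ℝ) (x + w) * f x ∂μ = ∫ x, (φ : E → ℝ) x * f (x - w) ∂μ := by
  rw [← integral_add_right_eq_self (fun x => (φ : E → ℝ) x * f (x - w)) w]
  simp

theorem eLpNorm_comp_add_right {F : Type*} [NormedAddCommGroup F] (f : E → F) (w : E) :
    eLpNorm (fun x => f (x + w)) 2 μ = eLpNorm f 2 μ := by
  have : eLpNorm (fun x => f (x + w)) 2 μ ^ 2 = eLpNorm f 2 μ ^ 2 := by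
    rw [eLpNorm_two_sq_eq_lintegral, eLpNorm_two_sq_eq_lintegral]
    exact lintegral_add_right_eq_self (fun x => ‖f x‖ₑ ^ 2) w
  exact (ENNReal.pow_right_strictMono two_ne_zero).injective this

theorem MeasureTheory.MemLp.comp_add_right {F : Type*} [NormedAddCommGroup F] {f : E → F}
    (hf : MemLp f 2 μ) (w : E) : MemLp (fun x => f (x + w)) 2 μ :=
  hf.comp_measurePreserving (measurePreserving_add_right μ w)

/-- A function whose translates in direction `v` are Lipschitz in `L²` has a weak derivative in
that direction, with the expected bound. -/
theorem exists_weak_deriv_of_translate {f : E → ℝ} (hf : MemLp f 2 μ) (v : E) {C δ : ℝ}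
    (hC : 0 ≤ C) (hδ : 0 < δ)
    (h : ∀ t : ℝ, |t| < δ →
      eLpNorm (fun x => f (x + t • v) - f x) 2 μ ≤ ENNReal.ofReal (|t| * C)) :
    ∃ g : E → ℝ, MemLp g 2 μ ∧ eLpNorm g 2 μ ≤ ENNReal.ofReal C ∧
      ∀ φ : testFunctions E, ∫ x, fderiv ℝ (φ : E → ℝ) x v * f x ∂μ
        = -∫ x, (φ : E → ℝ) x * g x ∂μ := by
  have hfl : LocallyIntegrable f μ := hf.locallyIntegrable (by norm_num)
  have hint : ∀ φ : testFunctions E, Integrable (fun x => fderiv ℝ (φ : E → ℝ) x v * f x) μ :=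
    fun φ => by
      simpa using hfl.integrable_smul_left_of_hasCompactSupport
        ((φ.2.1.continuous_fderiv (by simp)).clm_apply continuous_const)
        (φ.2.2.fderiv_apply (𝕜 := ℝ) v)
  have hdiff : ∀ φ : testFunctions E, Differentiable ℝ (φ : E → ℝ) :=
    fun φ => φ.2.1.differentiable (by simp)
  let l : testFunctions E →ₗ[ℝ] ℝ :=
    { toFun := fun φ => -∫ x, fderiv ℝ (φ : E → ℝ) x v * f x ∂μ
      map_add' := fun φ χ => by
        rw [← neg_add, ← integral_add (hint φ) (hint χ)]
        congr 1
        refine integral_congr_ae (Eventually.of_forall fun x => ?_)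
        have : fderiv ℝ ((φ + χ : testFunctions E) : E → ℝ) x
            = fderiv ℝ (φ : E → ℝ) x + fderiv ℝ (χ : E → ℝ) x :=
          fderiv_add (hdiff φ x) (hdiff χ x)
        simp only [this, _root_.add_apply]
        ring
      map_smul' := fun c φ => by
        simp only [RingHom.id_apply, smul_eq_mul]
        rw [mul_neg, ← integral_const_mul]
        congr 1
        refine integral_congr_ae (Eventually.of_forall fun x => ?_)
        have : fderiv ℝ ((c • φ : testFunctions E) : E → ℝ) x = c • fderiv ℝ (φ : E → ℝ) x :=
          fderiv_const_smul (hdiff φ x) c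
        simp only [this, _root_.smul_apply, smul_eq_mul]
        ring }
  obtain ⟨g, hg, hgC, hgl⟩ := exists_memLp_of_abs_le (μ := μ) l hC (fun φ => by
    simp only [l, LinearMap.coe_mk, AddHom.coe_mk, abs_neg]
    have hd := (hasDerivAt_integral_translate hfl φ v).tendsto_slope_zero
    have habs := hd.abs
    refine le_of_tendsto habs ?_
    have hmem : {t : ℝ | |t| < δ} ∈ 𝓝 (0 : ℝ) := by
      simpa [Metric.ball, dist_zero_right] using Metric.ball_mem_nhds (0 : ℝ) hδ
    filter_upwards [mem_nhdsWithin_of_mem_nhds hmem, self_mem_nhdsWithin] with t ht ht0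
    have hφ := testFunctions.memLp (μ := μ) φ
    have ht' := h (-t) (by simpa using ht)
    have hd2 : MemLp (fun x => f (x + (-t) • v) - f x) 2 μ := (hf.comp_add_right _).sub hf
    have e1 : ∫ x, (φ : E → ℝ) (x + (0 + t) • v) * f x ∂μ
          - ∫ x, (φ : E → ℝ) (x + (0:ℝ) • v) * f x ∂μ
        = ∫ x, (φ : E → ℝ) x * (f (x + (-t) • v) - f x) ∂μ := by
      rw [testFunctions.integral_translate_mul φ ((0 + t) • v)]
      simp only [zero_smul, add_zero, zero_add, mul_sub]
      rw [integral_sub]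
      · simp [sub_eq_add_neg]
      · exact hφ.integrable_mul (hf.comp_add_right _)
      · exact hφ.integrable_mul hf
    rw [e1, smul_eq_mul, abs_mul, abs_inv]
    have hcs := abs_integral_mul_le_eLpNorm_two hφ hd2
    have h3 : (eLpNorm (fun x => f (x + (-t) • v) - f x) 2 μ).toReal ≤ |t| * C := by
      rw [abs_neg] at ht'
      exact ENNReal.toReal_le_of_le_ofReal (by positivity) ht'
    have ht1 : 0 < |t| := abs_pos.2 ht0
    rw [inv_mul_le_iff₀ ht1]
    calc _ ≤ _ := hcs
      _ ≤ (eLpNorm (φ : E → ℝ) 2 μ).toReal * (|t| * C) := by gcongr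
      _ = _ := by ring)
  refine ⟨g, hg, hgC, fun φ => ?_⟩
  rw [← hgl φ]
  simp [l]

/-- Converse of `exists_weak_deriv_of_translate`. -/
theorem eLpNorm_translate_sub_le {f g : E → ℝ} (hf : MemLp f 2 μ) (hg : MemLp g 2 μ) (v : E)
    (hfg : ∀ φ : testFunctions E, ∫ x, fderiv ℝ (φ : E → ℝ) x v * f x ∂μ
        = -∫ x, (φ : E → ℝ) x * g x ∂μ) (t : ℝ) :
    eLpNorm (fun x => f (x + t • v) - f x) 2 μ
      ≤ ENNReal.ofReal (|t| * (eLpNorm g 2 μ).toReal) := by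
  have hfl : LocallyIntegrable f μ := hf.locallyIntegrable (by norm_num)
  have hd2 : MemLp (fun x => f (x + t • v) - f x) 2 μ := (hf.comp_add_right _).sub hf
  have hbound : ∀ φ : testFunctions E, |∫ x, (φ : E → ℝ) x * (f (x + t • v) - f x) ∂μ|
      ≤ (|t| * (eLpNorm g 2 μ).toReal) * (eLpNorm (φ : E → ℝ) 2 μ).toReal := by
    intro φ
    have hφ := testFunctions.memLp (μ := μ) φ
    let G : ℝ → ℝ := fun s => ∫ x, (φ : E → ℝ) (x + s • v) * f x ∂μ
    have hG : ∀ s : ℝ, HasDerivAt G (-∫ x, (φ : E → ℝ) (x + s • v) * g x ∂μ) s := by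
      intro s
      have h1 := hasDerivAt_integral_translate hfl (testFunctions.translate φ (s • v)) v
      rw [hfg] at h1
      have h2 : HasDerivAt (fun r : ℝ => r - s) 1 s := (hasDerivAt_id s).sub_const s
      let F : ℝ → ℝ := fun r => ∫ x, (testFunctions.translate φ (s • v) : E → ℝ) (x + r • v)
        * f x ∂μ
      have h1' : HasDerivAt F (-∫ x, (φ : E → ℝ) (x + s • v) * g x ∂μ) (s - s) := by
        rw [sub_self]
        exact h1
      have h3 := HasDerivAt.comp (h := fun r : ℝ => r - s) s h1' h2
      rw [mul_one] at h3
      have h4 : G = F ∘ fun r : ℝ => r - s := by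
        funext r
        simp only [G, F, Function.comp, testFunctions.translate]
        refine integral_congr_ae (Eventually.of_forall fun x => ?_)
        simp only
        rw [add_assoc, ← add_smul, sub_add_cancel]
      rw [h4]
      exact h3
    have hGb : ∀ s : ℝ, ‖-∫ x, (φ : E → ℝ) (x + s • v) * g x ∂μ‖
        ≤ (eLpNorm (φ : E → ℝ) 2 μ).toReal * (eLpNorm g 2 μ).toReal := by
      intro s
      rw [norm_neg, Real.norm_eq_abs]
      refine (abs_integral_mul_le_eLpNorm_two (hφ.comp_add_right (s • v)) hg).trans ?_
      rw [eLpNorm_comp_add_right]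
    have hmv := Convex.norm_image_sub_le_of_norm_hasDerivWithin_le (s := univ)
      (fun s _ => (hG s).hasDerivWithinAt) (fun s _ => hGb s) convex_univ (mem_univ 0)
      (mem_univ (-t))
    have e1 : G (-t) - G 0 = ∫ x, (φ : E → ℝ) x * (f (x + t • v) - f x) ∂μ := by
      simp only [G]
      rw [testFunctions.integral_translate_mul φ ((-t) • v)]
      simp only [zero_smul, add_zero, mul_sub]
      rw [integral_sub]
      · simp [sub_eq_add_neg]
      · exact hφ.integrable_mul (hf.comp_add_right _)
      · exact hφ.integrable_mul hf
    rw [← e1, ← Real.norm_eq_abs]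
    refine hmv.trans (le_of_eq ?_)
    simp
    ring
  let l : testFunctions E →ₗ[ℝ] ℝ :=
    { toFun := fun φ => ∫ x, (φ : E → ℝ) x * (f (x + t • v) - f x) ∂μ
      map_add' := fun φ χ => by
        refine Eq.trans ?_ (integral_add ((testFunctions.memLp φ).integrable_mul hd2)
          ((testFunctions.memLp χ).integrable_mul hd2))
        exact integral_congr_ae (Eventually.of_forall fun x => add_mul _ _ _)
      map_smul' := fun c φ => by
        simp only [RingHom.id_apply, smul_eq_mul]
        rw [← integral_const_mul]
        exact integral_congr_ae (Eventually.of_forall fun x => mul_assoc _ _ _) }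
  obtain ⟨w, hw, hwC, hwl⟩ := exists_memLp_of_abs_le (μ := μ) l (by positivity) hbound
  have hae : w =ᵐ[μ] fun x => f (x + t • v) - f x := by
    refine ae_eq_of_integral_contDiff_smul_eq (hw.locallyIntegrable (by norm_num))
      (hd2.locallyIntegrable (by norm_num)) fun φ h1 h2 => ?_
    exact (hwl ⟨φ, h1, h2⟩).symm
  rwa [← eLpNorm_congr_ae hae]

end Sobolev

namespace LevyLieb

/-! ### The kinetic energy in terms of translations -/

variable {N : ℕ}

theorem HasWeakPartial.ae_unique {ψ g g' : Config N → ℂ} {i : Fin N} {k : Fin 3}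
    (h : HasWeakPartial ψ g i k) (h' : HasWeakPartial ψ g' i k) : g =ᵐ[volume] g' := by
  refine ae_eq_of_integral_contDiff_smul_eq h.2.1 h'.2.1 fun φ h1 h2 => ?_
  rw [← neg_inj, ← h.2.2 φ h1 h2, ← h'.2.2 φ h1 h2]

theorem HasWeakPartial.weakPartial_ae_eq {ψ g : Config N → ℂ} {i : Fin N} {k : Fin 3}
    (h : HasWeakPartial ψ g i k) : weakPartial ψ i k =ᵐ[volume] g := by
  have hex : ∃ g, HasWeakPartial ψ g i k := ⟨g, h⟩
  rw [weakPartial, dif_pos hex]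
  exact hex.choose_spec.ae_unique h

theorem MemH1.memLp_weakPartial {ψ : Config N → ℂ} (h : MemH1 ψ) (i : Fin N) (k : Fin 3) :
    MemLp (weakPartial ψ i k) 2 := by
  obtain ⟨g, hg, hw⟩ := h.2 i k
  exact (memLp_congr_ae hw.weakPartial_ae_eq).2 hg

theorem MemH1.kineticEnergy_eq {ψ : Config N → ℂ} (h : MemH1 ψ) :
    kineticEnergy ψ = ∑ i : Fin N, ∑ k : Fin 3, ∫⁻ x, ‖weakPartial ψ i k x‖ₑ ^ 2 := by
  have hm : ∀ i k, AEMeasurable (fun x => ‖weakPartial ψ i k x‖ₑ ^ 2) volume := fun i k =>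
    ((h.memLp_weakPartial i k).1.enorm).pow_const 2
  rw [kineticEnergy, lintegral_finsetSum' _
    (fun i _ => Finset.aemeasurable_fun_sum _ fun k _ => hm i k)]
  exact Finset.sum_congr rfl fun i _ => lintegral_finsetSum' _ fun k _ => hm i k

theorem MemH1.lintegral_weakPartial_ne_top {ψ : Config N → ℂ} (h : MemH1 ψ) (i : Fin N)
    (k : Fin 3) : ∫⁻ x, ‖weakPartial ψ i k x‖ₑ ^ 2 ≠ ⊤ :=
  (memLp_two_iff_lintegral_sq (h.memLp_weakPartial i k).1).1 (h.memLp_weakPartial i k)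

theorem lintegral_translate_le_of_weak_deriv {f g : Config N → ℝ} (hf : MemLp f 2) (hg : MemLp g 2)
    (v : Config N) (hfg : ∀ φ : testFunctions (Config N),
      ∫ x, fderiv ℝ (φ : Config N → ℝ) x v * f x = -∫ x, (φ : Config N → ℝ) x * g x) (t : ℝ) :
    ∫⁻ x, ‖f (x + t • v) - f x‖ₑ ^ 2 ≤ ENNReal.ofReal (t ^ 2) * ∫⁻ x, ‖g x‖ₑ ^ 2 := by
  have h := eLpNorm_translate_sub_le hf hg v hfg t
  rw [← eLpNorm_two_sq_eq_lintegral, ← eLpNorm_two_sq_eq_lintegral]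
  refine (pow_le_pow_left₀ zero_le h 2).trans (le_of_eq ?_)
  rw [ENNReal.ofReal_mul (abs_nonneg t), mul_pow, ENNReal.ofReal_toReal hg.2.ne,
    ← ENNReal.ofReal_pow (abs_nonneg t), sq_abs]

theorem enorm_sq_eq_re_add_im (z : ℂ) : ‖z‖ₑ ^ 2 = ‖z.re‖ₑ ^ 2 + ‖z.im‖ₑ ^ 2 := by
  simp only [← ofReal_norm]
  rw [← ENNReal.ofReal_pow (norm_nonneg _), ← ENNReal.ofReal_pow (norm_nonneg _),
    ← ENNReal.ofReal_pow (norm_nonneg _), ← ENNReal.ofReal_add (by positivity) (by positivity)]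
  congr 1
  rw [← Complex.normSq_eq_norm_sq, Complex.normSq_apply, Real.norm_eq_abs, Real.norm_eq_abs,
    sq_abs, sq_abs, sq, sq]

/-- Translates of an `H¹` function are Lipschitz in `L²`. -/
theorem MemH1.lintegral_translate_le {ψ : Config N → ℂ} (h : MemH1 ψ) (i : Fin N) (k : Fin 3)
    (t : ℝ) : ∫⁻ x, ‖ψ (x + t • coordVec i k) - ψ x‖ₑ ^ 2
      ≤ ENNReal.ofReal (t ^ 2) * ∫⁻ x, ‖weakPartial ψ i k x‖ₑ ^ 2 := by
  obtain ⟨g, hg, hw⟩ := h.2 i k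
  have hgw : ∫⁻ x, ‖weakPartial ψ i k x‖ₑ ^ 2 = ∫⁻ x, ‖g x‖ₑ ^ 2 :=
    lintegral_congr_ae (hw.weakPartial_ae_eq.mono fun x hx => by simp only [hx])
  rw [hgw]
  obtain ⟨hψl, hgl, hw⟩ := hw
  have hi1 : ∀ φ : testFunctions (Config N), Integrable
      (fun x => fderiv ℝ (φ : Config N → ℝ) x (coordVec i k) • ψ x) := fun φ =>
    hψl.integrable_smul_left_of_hasCompactSupport
        ((φ.2.1.continuous_fderiv (by simp)).clm_apply continuous_const)
        (φ.2.2.fderiv_apply (𝕜 := ℝ) _)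
  have hi2 : ∀ φ : testFunctions (Config N), Integrable
      (fun x => (φ : Config N → ℝ) x • g x) := fun φ =>
    hgl.integrable_smul_left_of_hasCompactSupport φ.2.1.continuous φ.2.2
  have hre : ∀ φ : testFunctions (Config N),
      ∫ x, fderiv ℝ (φ : Config N → ℝ) x (coordVec i k) * (ψ x).re
        = -∫ x, (φ : Config N → ℝ) x * (g x).re := fun φ => by
    have e := congrArg Complex.re (hw φ φ.2.1 φ.2.2)
    have e1 := integral_re (𝕜 := ℂ) (hi1 φ)
    have e2 := integral_re (𝕜 := ℂ) (hi2 φ)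
    simp only [RCLike.re_to_complex, Complex.real_smul, Complex.re_ofReal_mul] at e1 e2
    simp only [Complex.neg_re, Complex.real_smul] at e
    rw [e1, e2, e]
  have him : ∀ φ : testFunctions (Config N),
      ∫ x, fderiv ℝ (φ : Config N → ℝ) x (coordVec i k) * (ψ x).im
        = -∫ x, (φ : Config N → ℝ) x * (g x).im := fun φ => by
    have e := congrArg Complex.im (hw φ φ.2.1 φ.2.2)
    have e1 := integral_im (𝕜 := ℂ) (hi1 φ)
    have e2 := integral_im (𝕜 := ℂ) (hi2 φ)
    simp only [RCLike.im_to_complex, Complex.real_smul, Complex.im_ofReal_mul] at e1 e2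
    simp only [Complex.neg_im, Complex.real_smul] at e
    rw [e1, e2, e]
  have hψre : MemLp (fun x => (ψ x).re) 2 volume := h.1.re
  have hψim : MemLp (fun x => (ψ x).im) 2 volume := h.1.im
  have hgre : MemLp (fun x => (g x).re) 2 volume := hg.re
  have hgim : MemLp (fun x => (g x).im) 2 volume := hg.im
  have b1 := lintegral_translate_le_of_weak_deriv hψre hgre _ hre t
  have b2 := lintegral_translate_le_of_weak_deriv hψim hgim _ him t
  simp only [enorm_sq_eq_re_add_im, Complex.sub_re, Complex.sub_im]
  have hm1 : AEMeasurable (fun x => ‖(ψ (x + t • coordVec i k)).re - (ψ x).re‖ₑ ^ 2) volume :=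
    (((hψre.comp_add_right _).sub hψre).1.enorm).pow_const 2
  rw [lintegral_add_left' hm1, lintegral_add_left' (hgre.1.enorm.pow_const 2), mul_add]
  exact add_le_add b1 b2

/-- An `L²` function whose translates along the coordinate vectors are Lipschitz in `L²` belongs
to `H¹`, and the Lipschitz constants control its kinetic energy. -/
theorem memH1_of_translate {f : Config N → ℝ} (hf : MemLp f 2) (C : Fin N → Fin 3 → ℝ≥0∞)
    (hC : ∀ i k, C i k ≠ ⊤) {δ : ℝ} (hδ : 0 < δ)
    (h : ∀ i k t, |t| < δ → ∫⁻ x, ‖f (x + t • coordVec i k) - f x‖ₑ ^ 2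
      ≤ ENNReal.ofReal (t ^ 2) * C i k) :
    MemH1 (fun x => (f x : ℂ)) ∧
      kineticEnergy (fun x => (f x : ℂ)) ≤ ∑ i : Fin N, ∑ k : Fin 3, C i k := by
  have key : ∀ i k, ∃ g : Config N → ℂ, MemLp g 2 ∧ ∫⁻ x, ‖g x‖ₑ ^ 2 ≤ C i k ∧
      HasWeakPartial (fun x => (f x : ℂ)) g i k := by
    intro i k
    obtain ⟨g, hg, hgC, hgw⟩ := exists_weak_deriv_of_translate hf (coordVec i k)
      (C := √(C i k).toReal) (Real.sqrt_nonneg _) hδ (fun t ht => by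
        have h1 := h i k t ht
        rw [← eLpNorm_two_sq_eq_lintegral] at h1
        rw [← ENNReal.pow_le_pow_left_iff two_ne_zero]
        refine h1.trans (le_of_eq ?_)
        rw [← ENNReal.ofReal_pow (by positivity), mul_pow, Real.sq_sqrt ENNReal.toReal_nonneg,
          sq_abs, ENNReal.ofReal_mul (by positivity), ENNReal.ofReal_toReal (hC i k)])
    refine ⟨fun x => (g x : ℂ), hg.ofReal, ?_, ?_, ?_, ?_⟩
    · have h2 : ∫⁻ x, ‖((g x : ℝ) : ℂ)‖ₑ ^ 2 = ∫⁻ x, ‖g x‖ₑ ^ 2 := by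
        refine lintegral_congr fun x => ?_
        rw [← ofReal_norm, ← ofReal_norm, Complex.norm_real]
      rw [h2, ← eLpNorm_two_sq_eq_lintegral]
      refine (pow_le_pow_left₀ zero_le hgC 2).trans (le_of_eq ?_)
      rw [← ENNReal.ofReal_pow (by positivity), Real.sq_sqrt ENNReal.toReal_nonneg,
        ENNReal.ofReal_toReal (hC i k)]
    · exact (hf.ofReal (K := ℂ)).locallyIntegrable (by norm_num)
    · exact (hg.ofReal (K := ℂ)).locallyIntegrable (by norm_num)
    · intro φ h1 h2
      have h3 := congrArg (fun r : ℝ => (r : ℂ)) (hgw ⟨φ, h1, h2⟩)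
      simp only [Complex.ofReal_neg, ← integral_complex_ofReal, Complex.ofReal_mul] at h3
      simpa using h3
  have hH1 : MemH1 (fun x => (f x : ℂ)) := by
    refine ⟨hf.ofReal, fun i k => ?_⟩
    obtain ⟨g, h1, -, h2⟩ := key i k
    exact ⟨g, h1, h2⟩
  refine ⟨hH1, ?_⟩
  rw [hH1.kineticEnergy_eq]
  refine Finset.sum_le_sum fun i _ => Finset.sum_le_sum fun k _ => ?_
  obtain ⟨g, -, h1, h2⟩ := key i k
  refine le_trans (le_of_eq ?_) h1
  exact lintegral_congr_ae (h2.weakPartial_ae_eq.mono fun x hx => by simp only [hx])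

end LevyLieb

/-- The reverse triangle inequality in `L²`. It also holds when both norms are infinite, because
`ENNReal.toReal` sends both to `0`. -/
theorem MeasureTheory.enorm_toReal_eLpNorm_sub_sq_le {Ω F : Type*} [MeasurableSpace Ω]
    {μ : Measure Ω} [NormedAddCommGroup F] {X Y : Ω → F} (hX : AEStronglyMeasurable X μ)
    (hY : AEStronglyMeasurable Y μ) :
    ‖(eLpNorm X 2 μ).toReal - (eLpNorm Y 2 μ).toReal‖ₑ ^ 2 ≤ ∫⁻ x, ‖X x - Y x‖ₑ ^ 2 ∂μ := by
  have hD : ∫⁻ x, ‖X x - Y x‖ₑ ^ 2 ∂μ = eLpNorm (X - Y) 2 μ ^ 2 :=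
    (eLpNorm_two_sq_eq_lintegral _).symm
  rw [hD]
  refine pow_le_pow_left₀ zero_le ?_ 2
  have h1 : eLpNorm X 2 μ ≤ eLpNorm (X - Y) 2 μ + eLpNorm Y 2 μ := by
    simpa using eLpNorm_add_le (hX.sub hY) hY (by norm_num : (1 : ℝ≥0∞) ≤ 2)
  have h2 : eLpNorm Y 2 μ ≤ eLpNorm (X - Y) 2 μ + eLpNorm X 2 μ := by
    have := eLpNorm_add_le (hY.sub hX) hX (by norm_num : (1 : ℝ≥0∞) ≤ 2)
    rw [eLpNorm_sub_comm] at this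
    simpa using this
  rcases eq_or_ne (eLpNorm (X - Y) 2 μ) ⊤ with hd | hd
  · rw [hd]; exact le_top
  rcases eq_or_ne (eLpNorm X 2 μ) ⊤ with hx | hx
  · have hy : eLpNorm Y 2 μ = ⊤ := by
      rw [hx, top_le_iff, ENNReal.add_eq_top] at h1
      exact h1.resolve_left hd
    simp [hx, hy]
  · have hy : eLpNorm Y 2 μ ≠ ⊤ := ne_top_of_le_ne_top (ENNReal.add_ne_top.2 ⟨hd, hx⟩) h2
    rw [← ofReal_norm, ← ENNReal.ofReal_toReal hd]
    apply ENNReal.ofReal_le_ofReal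
    have h1' := ENNReal.toReal_mono (ENNReal.add_ne_top.2 ⟨hd, hy⟩) h1
    have h2' := ENNReal.toReal_mono (ENNReal.add_ne_top.2 ⟨hd, hx⟩) h2
    rw [ENNReal.toReal_add hd hy] at h1'
    rw [ENNReal.toReal_add hd hx] at h2'
    rw [Real.norm_eq_abs, abs_le]
    constructor <;> linarith

theorem Real.enorm_sq_eq_ofReal_sq (x : ℝ) : ‖x‖ₑ ^ 2 = ENNReal.ofReal (x ^ 2) := by
  rw [← ofReal_norm, ← ENNReal.ofReal_pow (norm_nonneg _), Real.norm_eq_abs, sq_abs]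

theorem EuclideanSpace.enorm_sq_fin_three (x : EuclideanSpace ℝ (Fin 3)) :
    ‖x‖ₑ ^ 2 = ‖x 0‖ₑ ^ 2 + ‖x 1‖ₑ ^ 2 + ‖x 2‖ₑ ^ 2 := by
  rw [← ofReal_norm, ← ENNReal.ofReal_pow (norm_nonneg _), EuclideanSpace.norm_sq_eq,
    Fin.sum_univ_three]
  simp only [Real.enorm_sq_eq_ofReal_sq, Real.norm_eq_abs, sq_abs]
  rw [ENNReal.ofReal_add (by positivity) (by positivity),
    ENNReal.ofReal_add (by positivity) (by positivity)]

/-- The identity `‖R' V' - R V‖² = (R' - R)² + R' R ‖V' - V‖²` for unit vectors `V`, `V'`, combined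
with a bound on the variation of the first component of a unit vector in terms of the others. -/
theorem sq_sub_unit_le {R R' b c b' c' W W' : ℝ}
    (hb : b ^ 2 ≤ 1 / 4) (hc : c ^ 2 ≤ 1 / 4) (hb' : b' ^ 2 ≤ 1 / 4) (hc' : c' ^ 2 ≤ 1 / 4)
    (hW : 2 * ((b' - b) ^ 2 + (c' - c) ^ 2) ≤ W) (hW' : 2 * ((b' - b) ^ 2 + (c' - c) ^ 2) ≤ W') :
    (√(1 - b' ^ 2 - c' ^ 2) * R' - √(1 - b ^ 2 - c ^ 2) * R) ^ 2 + (b' * R' - b * R) ^ 2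
      + (c' * R' - c * R) ^ 2 ≤ (R' - R) ^ 2 + (W' * R' ^ 2 + W * R ^ 2) / 2 := by
  have ha2 : √(1 - b ^ 2 - c ^ 2) ^ 2 = 1 - b ^ 2 - c ^ 2 := Real.sq_sqrt (by linarith)
  have ha2' : √(1 - b' ^ 2 - c' ^ 2) ^ 2 = 1 - b' ^ 2 - c' ^ 2 := Real.sq_sqrt (by linarith)
  have ha0 : 0 ≤ √(1 - b ^ 2 - c ^ 2) := Real.sqrt_nonneg _
  have ha0' : 0 ≤ √(1 - b' ^ 2 - c' ^ 2) := Real.sqrt_nonneg _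
  generalize √(1 - b ^ 2 - c ^ 2) = a at ha2 ha0 ⊢
  generalize √(1 - b' ^ 2 - c' ^ 2) = a' at ha2' ha0' ⊢
  obtain ⟨D, hD⟩ : ∃ D, D = (b' - b) ^ 2 + (c' - c) ^ 2 := ⟨_, rfl⟩
  rw [← hD] at hW hW'
  have hD0 : 0 ≤ D := by rw [hD]; positivity
  have hA : (a' - a) ^ 2 ≤ D := by
    have h1 : (a' - a) * (a' + a) = -((b' - b) * (b' + b) + (c' - c) * (c' + c)) := by
      linear_combination ha2' - ha2
    have h2 : 2 ≤ (a' + a) ^ 2 := by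
      have h20 : (1 / 2 : ℝ) * (1 / 2) ≤ a ^ 2 * a' ^ 2 :=
        mul_le_mul (by linarith) (by linarith) (by norm_num) (sq_nonneg a)
      have h21 : 1 / 2 ≤ a * a' :=
        le_of_sq_le_sq (by linarith [mul_pow a a' 2]) (mul_nonneg ha0 ha0')
      nlinarith
    have h3 : ((b' - b) * (b' + b) + (c' - c) * (c' + c)) ^ 2
        ≤ D * ((b' + b) ^ 2 + (c' + c) ^ 2) := by
      rw [hD]
      nlinarith [sq_nonneg ((b' - b) * (c' + c) - (c' - c) * (b' + b))]
    have h4 : (b' + b) ^ 2 + (c' + c) ^ 2 ≤ 2 := by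
      nlinarith [sq_nonneg (b' - b), sq_nonneg (c' - c)]
    have h5 : (a' - a) ^ 2 * (a' + a) ^ 2 ≤ D * 2 := by
      rw [← mul_pow, h1, neg_sq]
      exact h3.trans (mul_le_mul_of_nonneg_left h4 hD0)
    have h6 : (a' - a) ^ 2 * 2 ≤ (a' - a) ^ 2 * (a' + a) ^ 2 :=
      mul_le_mul_of_nonneg_left h2 (sq_nonneg _)
    linarith
  have hid : (a' * R' - a * R) ^ 2 + (b' * R' - b * R) ^ 2 + (c' * R' - c * R) ^ 2
      = (R' - R) ^ 2 + R' * R * ((a' - a) ^ 2 + D) := by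
    rw [hD]
    linear_combination (R' ^ 2 - R' * R) * ha2' + (R ^ 2 - R * R') * ha2
  rw [hid]
  have hRR : R' * R ≤ (R' ^ 2 + R ^ 2) / 2 := by nlinarith [sq_nonneg (R' - R)]
  have h6 : R' * R * ((a' - a) ^ 2 + D) ≤ (R' ^ 2 + R ^ 2) / 2 * (2 * D) := by
    apply mul_le_mul hRR (by linarith) (by positivity) (by positivity)
  have h7 := mul_le_mul_of_nonneg_right hW (sq_nonneg R)
  have h8 := mul_le_mul_of_nonneg_right hW' (sq_nonneg R')
  linarith

namespace LevyLieb

/-! ### Exchanging one coordinate between two configurations -/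

variable {N : ℕ}

/-- The map on pairs of configurations that exchanges the positions of the particle `i`. -/
def exchange (i : Fin N) (z : Config N × Config N) : Config N × Config N :=
  (Function.update z.1 i (z.2 i), Function.update z.2 i (z.1 i))

@[simp] theorem exchange_exchange (i : Fin N) (z : Config N × Config N) :
    exchange i (exchange i z) = z := by
  simp [exchange]

theorem exchange_swap (i : Fin N) (z : Config N × Config N) :
    exchange i z.swap = (exchange i z).swap := rfl

theorem measurePreserving_exchange (i : Fin N) :
    MeasurePreserving (exchange (N := N) i) volume volume := by
  let e := MeasurableEquiv.arrowProdEquivProdArrow Space Space (Fin N)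
  have he : MeasurePreserving e volume volume :=
    volume_measurePreserving_arrowProdEquivProdArrow Space Space (Fin N)
  have hf : MeasurePreserving
      (fun (w : Fin N → Space × Space) j => (if j = i then Prod.swap else id) (w j))
      volume volume := by
    refine volume_preserving_pi fun j => ?_
    split_ifs
    · exact Measure.measurePreserving_swap
    · exact MeasurePreserving.id _
  have h := he.comp (hf.comp he.symm)
  convert h using 1
  funext z
  refine Prod.ext (funext fun j => ?_) (funext fun j => ?_)
  · by_cases hj : j = i
    · subst hj
      simp [exchange, e, MeasurableEquiv.arrowProdEquivProdArrow, Equiv.arrowProdEquivProdArrow]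
    · simp [exchange, e, hj, MeasurableEquiv.arrowProdEquivProdArrow, Equiv.arrowProdEquivProdArrow]
  · by_cases hj : j = i
    · subst hj
      simp [exchange, e, MeasurableEquiv.arrowProdEquivProdArrow, Equiv.arrowProdEquivProdArrow]
    · simp [exchange, e, hj, MeasurableEquiv.arrowProdEquivProdArrow, Equiv.arrowProdEquivProdArrow]

theorem measurePreserving_perm (σ : Equiv.Perm (Fin N)) :
    MeasurePreserving (fun (x : Config N) i => x (σ i)) volume volume := by
  have h := volume_measurePreserving_piCongrLeft (fun _ : Fin N => Space) σ.symm
  convert h using 1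
  funext x j
  have := MeasurableEquiv.piCongrLeft_apply_apply σ.symm (β := fun _ => Space) x (σ j)
  simpa using this.symm

theorem exchange_add (i : Fin N) (z w : Config N × Config N) :
    exchange i (z + w) = exchange i z + exchange i w := by
  refine Prod.ext (funext fun j => ?_) (funext fun j => ?_) <;>
  by_cases hj : j = i <;> simp [exchange, hj]

theorem exchange_coordVec_of_ne {i j : Fin N} (h : j ≠ i) (k : Fin 3) (t : ℝ) :
    exchange i (t • coordVec j k, 0) = (t • coordVec j k, 0) := by
  refine Prod.ext (funext fun l => ?_) (funext fun l => ?_) <;>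
  by_cases hl : l = i <;> simp [exchange, hl, coordVec, h.symm]

theorem exchange_coordVec_self (i : Fin N) (k : Fin 3) (t : ℝ) :
    exchange i (t • coordVec i k, 0) = (0, t • coordVec i k) := by
  refine Prod.ext (funext fun l => ?_) (funext fun l => ?_) <;>
  by_cases hl : l = i <;> simp [exchange, hl, coordVec]

/-! ### The exchanged state -/

/-- The part of the product state `r ⊗ r` that is selected by the amplitude `b`. -/
noncomputable def pairAmplitude (r : Config N → ℝ) (b : Config N × Config N → ℝ)
    (z : Config N × Config N) : ℝ :=
  b z * (r z.1 * r z.2)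

/-- The three components of the doubled system after the exchange: what is left of `r ⊗ r` once
the selected part is removed in both orderings of the two copies, and the selected part with the
particle `i` exchanged, again in both orderings. -/
noncomputable def exchangeAmplitude (i : Fin N) (r : Config N → ℝ)
    (b : Config N × Config N → ℝ) (z : Config N × Config N) : EuclideanSpace ℝ (Fin 3) :=
  !₂[√(1 - b z ^ 2 - b z.swap ^ 2) * (r z.1 * r z.2), pairAmplitude r b (exchange i z),
    pairAmplitude r b (exchange i z).swap]

/-- The first marginal of the doubled system after the exchange. -/
noncomputable def exchangeDensity (i : Fin N) (r : Config N → ℝ)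
    (b : Config N × Config N → ℝ) (u : Config N) : ℝ≥0∞ :=
  ∫⁻ v, ‖exchangeAmplitude i r b (u, v)‖ₑ ^ 2

/-- The square root of `exchangeDensity`. -/
noncomputable def exchangeState (i : Fin N) (r : Config N → ℝ)
    (b : Config N × Config N → ℝ) (u : Config N) : ℝ :=
  (eLpNorm (fun v => exchangeAmplitude i r b (u, v)) 2 volume).toReal

variable {i : Fin N} {r : Config N → ℝ} {b : Config N × Config N → ℝ}

theorem measurable_pairAmplitude (hr : Measurable r) (hb : Measurable b) :
    Measurable (pairAmplitude r b) :=
  hb.mul ((hr.comp measurable_fst).mul (hr.comp measurable_snd))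

theorem measurable_exchangeAmplitude (hr : Measurable r) (hb : Measurable b) :
    Measurable (exchangeAmplitude i r b) := by
  have hp := measurable_pairAmplitude hr hb
  have hs := (measurePreserving_exchange i).measurable
  refine (WithLp.measurable_toLp 2 _).comp ?_
  refine measurable_pi_iff.2 fun k => ?_
  fin_cases k
  · exact (((measurable_const.sub (hb.pow_const 2)).sub
      ((hb.comp measurable_swap).pow_const 2)).sqrt).mul
      ((hr.comp measurable_fst).mul (hr.comp measurable_snd))
  · exact hp.comp hs
  · exact hp.comp (measurable_swap.comp hs)

theorem measurable_exchangeDensity (hr : Measurable r) (hb : Measurable b) :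
    Measurable (exchangeDensity i r b) :=
  Measurable.lintegral_prod_right'
    (f := fun z => ‖exchangeAmplitude i r b z‖ₑ ^ 2)
    ((measurable_exchangeAmplitude hr hb).enorm.pow_const 2)

theorem exchangeState_eq (u : Config N) :
    exchangeState i r b u = √(exchangeDensity i r b u).toReal := by
  rw [exchangeState, exchangeDensity, ← eLpNorm_two_sq_eq_lintegral, ENNReal.toReal_pow,
    Real.sqrt_sq ENNReal.toReal_nonneg]

theorem measurable_exchangeState (hr : Measurable r) (hb : Measurable b) :
    Measurable (exchangeState i r b) := by
  have : exchangeState i r b = fun u => √(exchangeDensity i r b u).toReal :=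
    funext exchangeState_eq
  rw [this]
  exact (measurable_exchangeDensity hr hb).ennreal_toReal.sqrt

theorem enorm_exchangeState_sq {u : Config N} (h : exchangeDensity i r b u ≠ ⊤) :
    ‖exchangeState i r b u‖ₑ ^ 2 = exchangeDensity i r b u := by
  rw [exchangeState_eq, Real.enorm_sq_eq_ofReal_sq, Real.sq_sqrt ENNReal.toReal_nonneg,
    ENNReal.ofReal_toReal h]

theorem enorm_exchangeAmplitude_sq (z : Config N × Config N) :
    ‖exchangeAmplitude i r b z‖ₑ ^ 2 = ‖√(1 - b z ^ 2 - b z.swap ^ 2) * (r z.1 * r z.2)‖ₑ ^ 2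
      + ‖pairAmplitude r b (exchange i z)‖ₑ ^ 2
      + ‖pairAmplitude r b (exchange i z).swap‖ₑ ^ 2 := by
  rw [EuclideanSpace.enorm_sq_fin_three]
  simp [exchangeAmplitude]

theorem enorm_sq_remainder_add (hb4 : ∀ z, b z ^ 2 ≤ 1 / 4) (z : Config N × Config N) :
    ‖√(1 - b z ^ 2 - b z.swap ^ 2) * (r z.1 * r z.2)‖ₑ ^ 2
      + ‖pairAmplitude r b z‖ₑ ^ 2 + ‖pairAmplitude r b z.swap‖ₑ ^ 2
      = ‖r z.1‖ₑ ^ 2 * ‖r z.2‖ₑ ^ 2 := by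
  have h1 := hb4 z
  have h2 := hb4 z.swap
  simp only [Real.enorm_sq_eq_ofReal_sq, pairAmplitude]
  rw [← ENNReal.ofReal_add (by positivity) (by positivity),
    ← ENNReal.ofReal_add (by positivity) (by positivity), ← ENNReal.ofReal_mul (by positivity),
    mul_pow, Real.sq_sqrt (by linarith)]
  congr 1
  simp only [Prod.fst_swap, Prod.snd_swap]
  ring

theorem lintegral_fst_mul_of_mass_one (hr : Measurable r) (hr1 : ∫⁻ x, ‖r x‖ₑ ^ 2 = 1)
    {V : Config N → ℝ≥0∞} (hV : Measurable V) :
    ∫⁻ z : Config N × Config N, V z.1 * (‖r z.1‖ₑ ^ 2 * ‖r z.2‖ₑ ^ 2)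
      = ∫⁻ x, V x * ‖r x‖ₑ ^ 2 := by
  have hP : Measurable fun x => ‖r x‖ₑ ^ 2 := hr.enorm.pow_const 2
  rw [Measure.volume_eq_prod, lintegral_prod]
  · refine lintegral_congr fun x => ?_
    simp only [← mul_assoc]
    rw [lintegral_const_mul _ hP, hr1, mul_one]
  · exact ((hV.comp measurable_fst).mul
      ((hP.comp measurable_fst).mul (hP.comp measurable_snd))).aemeasurable

/-- Balance of an observable `V` under the exchange: the selected pairs lose their value of `V`
before the exchange and gain their value after it. -/
theorem lintegral_mul_exchangeDensity (hr : Measurable r) (hb : Measurable b)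
    (hr1 : ∫⁻ x, ‖r x‖ₑ ^ 2 = 1) (hb4 : ∀ z, b z ^ 2 ≤ 1 / 4) {V : Config N → ℝ≥0∞}
    (hV : Measurable V) :
    (∫⁻ x, V x * exchangeDensity i r b x)
        + ∫⁻ z : Config N × Config N, (V z.1 + V z.2) * ‖pairAmplitude r b z‖ₑ ^ 2
      = (∫⁻ x, V x * ‖r x‖ₑ ^ 2)
        + ∫⁻ z : Config N × Config N,
          (V (exchange i z).1 + V (exchange i z).2) * ‖pairAmplitude r b z‖ₑ ^ 2 := by
  have hs := measurePreserving_exchange i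
  have hsw : MeasurePreserving (Prod.swap : Config N × Config N → _) volume volume :=
    Measure.measurePreserving_swap
  have hG : Measurable fun z => ‖pairAmplitude r b z‖ₑ ^ 2 :=
    (measurable_pairAmplitude hr hb).enorm.pow_const 2
  have hV1 : Measurable fun z : Config N × Config N => V z.1 := hV.comp measurable_fst
  have hV2 : Measurable fun z : Config N × Config N => V z.2 := hV.comp measurable_snd
  set A : Config N × Config N → ℝ≥0∞ := fun z =>
    ‖√(1 - b z ^ 2 - b z.swap ^ 2) * (r z.1 * r z.2)‖ₑ ^ 2 with hAdef
  have hA : Measurable A :=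
    ((((measurable_const.sub (hb.pow_const 2)).sub
      ((hb.comp measurable_swap).pow_const 2)).sqrt).mul
      ((hr.comp measurable_fst).mul (hr.comp measurable_snd))).enorm.pow_const 2
  have e1 : ∫⁻ x, V x * exchangeDensity i r b x
      = (∫⁻ z : Config N × Config N, V z.1 * A z)
        + ∫⁻ z : Config N × Config N, (V (exchange i z).1 + V (exchange i z).2)
          * ‖pairAmplitude r b z‖ₑ ^ 2 := by
    have h1 : ∫⁻ x, V x * exchangeDensity i r b x
        = ∫⁻ z : Config N × Config N, V z.1 * ‖exchangeAmplitude i r b z‖ₑ ^ 2 := by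
      have hF : Measurable fun z => ‖exchangeAmplitude i r b z‖ₑ ^ 2 :=
        (measurable_exchangeAmplitude hr hb).enorm.pow_const 2
      have hVF : Measurable fun z : Config N × Config N =>
          V z.1 * ‖exchangeAmplitude i r b z‖ₑ ^ 2 :=
        hV1.mul hF
      rw [Measure.volume_eq_prod, lintegral_prod _ hVF.aemeasurable]
      refine lintegral_congr fun x => ?_
      exact (lintegral_const_mul _ (hF.comp measurable_prodMk_left)).symm
    rw [h1]
    simp only [enorm_exchangeAmplitude_sq, mul_add, add_mul]
    rw [lintegral_add_right, lintegral_add_right, lintegral_add_right, add_assoc]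
    · congr 2
      · rw [← hs.lintegral_comp (f := fun z => V (exchange i z).1 * ‖pairAmplitude r b z‖ₑ ^ 2)
          ((hV1.comp hs.measurable).mul hG)]
        simp
      · rw [← (hsw.comp hs).lintegral_comp
          (f := fun z => V (exchange i z).2 * ‖pairAmplitude r b z‖ₑ ^ 2)
          ((hV2.comp hs.measurable).mul hG)]
        simp [exchange_swap]
    · exact (hV2.comp hs.measurable).mul hG
    · exact hV1.mul (hG.comp hs.measurable)
    · exact hV1.mul (hG.comp (measurable_swap.comp hs.measurable))
  have e2 : ∫⁻ x, V x * ‖r x‖ₑ ^ 2 = (∫⁻ z : Config N × Config N, V z.1 * A z)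
      + ∫⁻ z : Config N × Config N, (V z.1 + V z.2) * ‖pairAmplitude r b z‖ₑ ^ 2 := by
    rw [← lintegral_fst_mul_of_mass_one hr hr1 hV]
    simp only [← enorm_sq_remainder_add hb4, mul_add, add_mul]
    rw [lintegral_add_right, lintegral_add_right, lintegral_add_right, add_assoc]
    · congr 2
      rw [← hsw.lintegral_comp (f := fun z => V z.2 * ‖pairAmplitude r b z‖ₑ ^ 2) (hV2.mul hG)]
      simp
    · exact hV2.mul hG
    · exact hV1.mul hG
    · exact hV1.mul (hG.comp measurable_swap)
  rw [e1, e2]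
  ring

theorem lintegral_pairAmplitude_ne_top (hr : Measurable r)
    (hr1 : ∫⁻ x, ‖r x‖ₑ ^ 2 = 1) (hb4 : ∀ z, b z ^ 2 ≤ 1 / 4) :
    ∫⁻ z, ‖pairAmplitude r b z‖ₑ ^ 2 ≠ ⊤ := by
  refine ne_top_of_le_ne_top ENNReal.one_ne_top ?_
  have h := lintegral_fst_mul_of_mass_one hr hr1 (V := fun _ => 1) measurable_const
  simp only [one_mul, hr1] at h
  rw [← h]
  refine lintegral_mono fun z => ?_
  simp only
  rw [← enorm_sq_remainder_add hb4 z, add_right_comm]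
  exact le_add_self

/-- A bounded observable whose sum over the two copies is invariant under the exchange keeps its
expectation. -/
theorem lintegral_mul_exchangeDensity_of_invariant (hr : Measurable r) (hb : Measurable b)
    (hr1 : ∫⁻ x, ‖r x‖ₑ ^ 2 = 1) (hb4 : ∀ z, b z ^ 2 ≤ 1 / 4) {V : Config N → ℝ≥0∞}
    (hV : Measurable V) (hV1 : ∀ x, V x ≤ 1)
    (hinv : ∀ z, V (exchange i z).1 + V (exchange i z).2 = V z.1 + V z.2) :
    ∫⁻ x, V x * exchangeDensity i r b x = ∫⁻ x, V x * ‖r x‖ₑ ^ 2 := by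
  have h := lintegral_mul_exchangeDensity (i := i) hr hb hr1 hb4 hV
  simp only [hinv] at h
  refine (ENNReal.add_left_inj ?_).1 h
  refine ne_top_of_le_ne_top (ENNReal.mul_ne_top (a := 2) (by norm_num)
    (lintegral_pairAmplitude_ne_top hr hr1 hb4)) ?_
  rw [← lintegral_const_mul _ ((measurable_pairAmplitude hr hb).enorm.pow_const 2)]
  refine lintegral_mono fun z => mul_le_mul_left ?_ _
  rw [← one_add_one_eq_two]
  exact add_le_add (hV1 _) (hV1 _)

/-- The exchange does not change the one-particle marginals. -/
theorem lintegral_indicator_mul_exchangeDensity (hr : Measurable r) (hb : Measurable b)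
    (hr1 : ∫⁻ x, ‖r x‖ₑ ^ 2 = 1) (hb4 : ∀ z, b z ^ 2 ≤ 1 / 4) (j : Fin N) {S : Set Space}
    (hS : MeasurableSet S) :
    ∫⁻ x : Config N, S.indicator 1 (x j) * exchangeDensity i r b x
      = ∫⁻ x : Config N, S.indicator 1 (x j) * ‖r x‖ₑ ^ 2 := by
  refine lintegral_mul_exchangeDensity_of_invariant (V := fun x => S.indicator 1 (x j))
    hr hb hr1 hb4 ((measurable_one.indicator hS).comp (measurable_pi_apply j))
    (fun x => indicator_le_self' (fun _ _ => zero_le) _) (fun z => ?_)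
  by_cases hj : j = i
  · subst hj
    simp [exchange, add_comm]
  · simp [exchange, hj]

theorem lintegral_exchangeDensity (hr : Measurable r) (hb : Measurable b)
    (hr1 : ∫⁻ x, ‖r x‖ₑ ^ 2 = 1) (hb4 : ∀ z, b z ^ 2 ≤ 1 / 4) :
    ∫⁻ x, exchangeDensity i r b x = 1 := by
  have h := lintegral_mul_exchangeDensity_of_invariant (i := i) (V := fun _ => 1)
    hr hb hr1 hb4 measurable_const (fun _ => le_rfl) (fun _ => rfl)
  simpa [hr1] using h

theorem exchangeState_sq_ae_eq (hr : Measurable r) (hb : Measurable b)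
    (hr1 : ∫⁻ x, ‖r x‖ₑ ^ 2 = 1) (hb4 : ∀ z, b z ^ 2 ≤ 1 / 4) :
    (fun x => ‖exchangeState i r b x‖ₑ ^ 2) =ᵐ[volume] exchangeDensity i r b := by
  have h := ae_lt_top (measurable_exchangeDensity (i := i) hr hb)
    (by rw [lintegral_exchangeDensity hr hb hr1 hb4]; exact ENNReal.one_ne_top)
  filter_upwards [h] with x hx using enorm_exchangeState_sq hx.ne

/-- The translations of the exchanged state, in terms of the translations of `r` and of `b`. The
exchange only relabels coordinates, so that both orderings of the selected part contribute the
same directions as before; the rest is the localization formula `sq_sub_unit_le`. -/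
theorem lintegral_exchangeState_translate_le (hr : Measurable r) (hb : Measurable b)
    (hr1 : ∫⁻ x, ‖r x‖ₑ ^ 2 = 1) (hb4 : ∀ z, b z ^ 2 ≤ 1 / 4) (j : Fin N) (k : Fin 3)
    {W : Config N × Config N → ℝ} (hWm : Measurable W) (hW0 : ∀ z, 0 ≤ W z) {δ : ℝ}
    (hW : ∀ z t, |t| < δ → 2 * ((b (z + (t • coordVec j k, 0)) - b z) ^ 2
      + (b (z + (t • coordVec j k, 0)).swap - b z.swap) ^ 2) ≤ t ^ 2 * W z) {t : ℝ}
    (ht : |t| < δ) :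
    ∫⁻ u, ‖exchangeState i r b (u + t • coordVec j k) - exchangeState i r b u‖ₑ ^ 2
      ≤ (∫⁻ u, ‖r (u + t • coordVec j k) - r u‖ₑ ^ 2)
        + ENNReal.ofReal (t ^ 2) * ∫⁻ z : Config N × Config N,
          ENNReal.ofReal (W z) * (‖r z.1‖ₑ ^ 2 * ‖r z.2‖ₑ ^ 2) := by
  have hs := measurePreserving_exchange i
  have hsw : MeasurePreserving (Prod.swap : Config N × Config N → _) volume volume :=
    Measure.measurePreserving_swap
  have hF := measurable_exchangeAmplitude (i := i) hr hb
  have hp := measurable_pairAmplitude hr hb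
  set e : Config N := t • coordVec j k with he
  set d : Config N × Config N := (e, 0) with hd
  have htr : Measurable fun z : Config N × Config N => z + d := measurable_id.add_const d
  have htr' : Measurable fun z : Config N × Config N => z + d.swap :=
    measurable_id.add_const d.swap
  -- the reverse triangle inequality in the second copy
  have h1 : ∫⁻ u, ‖exchangeState i r b (u + e) - exchangeState i r b u‖ₑ ^ 2
      ≤ ∫⁻ z : Config N × Config N,
        ‖exchangeAmplitude i r b (z + d) - exchangeAmplitude i r b z‖ₑ ^ 2 := by
    have hm : Measurable fun z : Config N × Config N =>
        ‖exchangeAmplitude i r b (z + d) - exchangeAmplitude i r b z‖ₑ ^ 2 :=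
      ((hF.comp htr).sub hF).enorm.pow_const 2
    rw [Measure.volume_eq_prod, lintegral_prod _ hm.aemeasurable]
    refine lintegral_mono fun u => ?_
    have := enorm_toReal_eLpNorm_sub_sq_le (μ := (volume : Measure (Config N)))
      (X := fun v => exchangeAmplitude i r b (u + e, v))
      (Y := fun v => exchangeAmplitude i r b (u, v))
      (hF.comp measurable_prodMk_left).aestronglyMeasurable
      (hF.comp measurable_prodMk_left).aestronglyMeasurable
    simpa [exchangeState, hd] using this
  -- the components of the amplitude
  set D : Config N × Config N → ℝ≥0∞ := fun z =>
    ‖√(1 - b (z + d) ^ 2 - b (z + d).swap ^ 2) * (r (z + d).1 * r (z + d).2)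
      - √(1 - b z ^ 2 - b z.swap ^ 2) * (r z.1 * r z.2)‖ₑ ^ 2 with hD
  set G1 : Config N × Config N → ℝ≥0∞ := fun z =>
    ‖pairAmplitude r b (z + d) - pairAmplitude r b z‖ₑ ^ 2 with hG1
  set G2 : Config N × Config N → ℝ≥0∞ := fun z =>
    ‖pairAmplitude r b (z + d.swap) - pairAmplitude r b z‖ₑ ^ 2 with hG2
  have hDm : Measurable D := by
    have hf : Measurable fun z : Config N × Config N =>
        √(1 - b z ^ 2 - b z.swap ^ 2) * (r z.1 * r z.2) :=
      (((measurable_const.sub (hb.pow_const 2)).sub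
        ((hb.comp measurable_swap).pow_const 2)).sqrt).mul
        ((hr.comp measurable_fst).mul (hr.comp measurable_snd))
    exact ((hf.comp htr).sub hf).enorm.pow_const 2
  have hG1m : Measurable G1 := ((hp.comp htr).sub hp).enorm.pow_const 2
  have hG2m : Measurable G2 := ((hp.comp htr').sub hp).enorm.pow_const 2
  have h2 : ∫⁻ z : Config N × Config N,
        ‖exchangeAmplitude i r b (z + d) - exchangeAmplitude i r b z‖ₑ ^ 2
      = (∫⁻ z, D z) + (∫⁻ z, G1 z) + ∫⁻ z, G2 z := by
    have h3 : ∀ z, ‖exchangeAmplitude i r b (z + d) - exchangeAmplitude i r b z‖ₑ ^ 2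
        = D z + ‖pairAmplitude r b (exchange i z + exchange i d)
            - pairAmplitude r b (exchange i z)‖ₑ ^ 2
          + ‖pairAmplitude r b ((exchange i z).swap + (exchange i d).swap)
            - pairAmplitude r b (exchange i z).swap‖ₑ ^ 2 := by
      intro z
      rw [EuclideanSpace.enorm_sq_fin_three]
      simp [exchangeAmplitude, exchange_add, hD]
    simp only [h3]
    by_cases hj : j = i
    · have hed : exchange i d = d.swap := by
        subst hj
        exact exchange_coordVec_self j k t
      simp only [hed, Prod.swap_swap]
      have a1 := hs.lintegral_comp hG2m
      have a2 := (hsw.comp hs).lintegral_comp hG1m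
      rw [← a1, ← a2, add_right_comm, ← lintegral_add_left hDm, ← lintegral_add_left
        (show Measurable fun z => D z + G2 (exchange i z) from hDm.add (hG2m.comp hs.measurable))]
      rfl
    · have hed : exchange i d = d := exchange_coordVec_of_ne hj k t
      simp only [hed]
      have a1 := hs.lintegral_comp hG1m
      have a2 := (hsw.comp hs).lintegral_comp hG2m
      rw [← a1, ← a2, ← lintegral_add_left hDm, ← lintegral_add_left
        (show Measurable fun z => D z + G1 (exchange i z) from hDm.add (hG1m.comp hs.measurable))]
      rfl
  set R : Config N × Config N → ℝ := fun z => r z.1 * r z.2 with hR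
  have hRm : Measurable R := (hr.comp measurable_fst).mul (hr.comp measurable_snd)
  -- the pointwise estimate
  have h4 : ∀ z, D z + G1 z + G2 z.swap ≤ ‖R (z + d) - R z‖ₑ ^ 2
      + (ENNReal.ofReal (t ^ 2 / 2) * (ENNReal.ofReal (W (z + d)) * ‖R (z + d)‖ₑ ^ 2)
        + ENNReal.ofReal (t ^ 2 / 2) * (ENNReal.ofReal (W z) * ‖R z‖ₑ ^ 2)) := by
    intro z
    have hw := hW z t ht
    have hw' := hW (z + d) (-t) (by rwa [abs_neg])
    have hzd : z + d + ((-t) • coordVec j k, 0) = z := by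
      refine Prod.ext ?_ ?_ <;> simp [hd, he]
    rw [hzd] at hw'
    rw [← he, ← hd] at hw
    have key := sq_sub_unit_le (R := R z) (R' := R (z + d)) (b := b z) (c := b z.swap)
      (b' := b (z + d)) (c' := b (z + d).swap) (W := t ^ 2 * W z) (W' := t ^ 2 * W (z + d))
      (hb4 _) (hb4 _) (hb4 _) (hb4 _) hw (by
        refine le_trans (le_of_eq ?_) (hw'.trans (le_of_eq ?_)) <;> ring)
    have hswap : z.swap + d.swap = (z + d).swap := by simp
    simp only [hD, hG1, hG2, pairAmplitude, Real.enorm_sq_eq_ofReal_sq, hswap]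
    have hW0z := hW0 z
    have hW0d := hW0 (z + d)
    rw [← ENNReal.ofReal_add (by positivity) (by positivity),
      ← ENNReal.ofReal_add (by positivity) (by positivity), ← ENNReal.ofReal_mul (by positivity),
      ← ENNReal.ofReal_mul (by positivity), ← ENNReal.ofReal_mul (by positivity),
      ← ENNReal.ofReal_mul (by positivity), ← ENNReal.ofReal_add (by positivity) (by positivity),
      ← ENNReal.ofReal_add (by positivity) (by positivity)]
    apply ENNReal.ofReal_le_ofReal
    simp only [Prod.fst_swap, Prod.snd_swap]
    have e1 : r (z + d).2 * r (z + d).1 = R (z + d) := mul_comm _ _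
    have e2 : r z.2 * r z.1 = R z := mul_comm _ _
    rw [e1, e2]
    refine key.trans (le_of_eq ?_)
    ring
  have hRsq : ∀ z, ‖R z‖ₑ ^ 2 = ‖r z.1‖ₑ ^ 2 * ‖r z.2‖ₑ ^ 2 := fun z => by
    rw [hR]; simp only [enorm_mul, mul_pow]
  have h5 : ∫⁻ z, ‖R (z + d) - R z‖ₑ ^ 2 = ∫⁻ u, ‖r (u + e) - r u‖ₑ ^ 2 := by
    have hq : Measurable fun u => ‖r (u + e) - r u‖ₑ ^ 2 :=
      ((hr.comp (measurable_id.add_const e)).sub hr).enorm.pow_const 2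
    have hP : Measurable fun x => ‖r x‖ₑ ^ 2 := hr.enorm.pow_const 2
    have : ∀ z : Config N × Config N,
        ‖R (z + d) - R z‖ₑ ^ 2 = ‖r (z.1 + e) - r z.1‖ₑ ^ 2 * ‖r z.2‖ₑ ^ 2 := fun z => by
      rw [← mul_pow, ← enorm_mul]
      simp [hR, hd, sub_mul]
    simp only [this]
    rw [Measure.volume_eq_prod, lintegral_prod_mul hq.aemeasurable hP.aemeasurable, hr1, mul_one]
  have hWR : Measurable fun z => ENNReal.ofReal (W z) * ‖R z‖ₑ ^ 2 :=
    hWm.ennreal_ofReal.mul (hRm.enorm.pow_const 2)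
  have h6 : ∫⁻ z, ENNReal.ofReal (W (z + d)) * ‖R (z + d)‖ₑ ^ 2
      = ∫⁻ z, ENNReal.ofReal (W z) * ‖R z‖ₑ ^ 2 := by
    have htp := (measurePreserving_add_right (volume : Measure (Config N)) e).prod
      (MeasurePreserving.id (volume : Measure (Config N)))
    have h7 := htp.lintegral_comp hWR
    rw [Measure.volume_eq_prod, ← h7]
    refine lintegral_congr fun z => ?_
    have hzd : z + d = Prod.map (fun x => x + e) id z := by
      refine Prod.ext ?_ ?_ <;> simp [hd]
    rw [hzd]
  refine h1.trans ?_
  rw [h2, ← hsw.lintegral_comp hG2m, ← lintegral_add_left hDm, ← lintegral_add_left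
    (show Measurable fun z => D z + G1 z from hDm.add hG1m)]
  refine (lintegral_mono h4).trans ?_
  have hWRd : Measurable fun z => ENNReal.ofReal (W (z + d)) * ‖R (z + d)‖ₑ ^ 2 := hWR.comp htr
  have hRd : Measurable fun z => ‖R (z + d) - R z‖ₑ ^ 2 :=
    ((hRm.comp htr).sub hRm).enorm.pow_const 2
  rw [lintegral_add_left hRd, lintegral_add_left (hWRd.const_mul _), h5,
    lintegral_const_mul _ hWRd, lintegral_const_mul _ hWR,
    h6, ← add_mul, ← ENNReal.ofReal_add (by positivity) (by positivity), add_halves]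
  simp only [hRsq]
  exact le_rfl

end LevyLieb

/-- The reverse triangle inequality for a weighted Euclidean norm. -/
theorem sq_sqrt_mul_sum_sub_le {ι : Type*} [Fintype ι] {c : ℝ} (hc : 0 ≤ c) (a b : ι → ℝ) :
    (√(c * ∑ i, a i ^ 2) - √(c * ∑ i, b i ^ 2)) ^ 2 ≤ c * ∑ i, (a i - b i) ^ 2 := by
  have h := abs_norm_sub_norm_le (WithLp.toLp 2 a : EuclideanSpace ℝ ι) (WithLp.toLp 2 b)
  simp only [EuclideanSpace.norm_eq, Real.norm_eq_abs, sq_abs, PiLp.sub_apply] at h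
  rw [Real.sqrt_mul hc, Real.sqrt_mul hc, ← mul_sub, mul_pow, Real.sq_sqrt hc]
  refine mul_le_mul_of_nonneg_left ?_ hc
  have h2 := pow_le_pow_left₀ (abs_nonneg _) h 2
  rwa [sq_abs, Real.sq_sqrt (Finset.sum_nonneg fun i _ => sq_nonneg _)] at h2

namespace LevyLieb

/-! ### Symmetrization -/

variable {N : ℕ}

theorem hasDensity_iff {ψ : Config N → ℂ} {ρ : Measure Space} :
    HasDensity ψ ρ ↔ ∀ (j : Fin N) (S : Set Space), MeasurableSet S →
      (N : ℝ≥0∞) * ∫⁻ x : Config N, S.indicator 1 (x j) * ‖ψ x‖ₑ ^ 2 = ρ S := by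
  have key : ∀ (j : Fin N) (S : Set Space), MeasurableSet S →
      ((N : ℝ≥0∞) • (positionMeasure ψ).map (fun x => x j)) S
        = (N : ℝ≥0∞) * ∫⁻ x : Config N, S.indicator 1 (x j) * ‖ψ x‖ₑ ^ 2 := by
    intro j S hS
    have hS' : MeasurableSet ((fun x : Config N => x j) ⁻¹' S) :=
      hS.preimage (measurable_pi_apply j)
    rw [Measure.smul_apply, Measure.map_apply (measurable_pi_apply j) hS, positionMeasure,
      withDensity_apply _ hS', ← lintegral_indicator hS', smul_eq_mul]
    congr 1
    refine lintegral_congr fun x => ?_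
    by_cases hx : x j ∈ S <;> simp [indicator, hx]
  constructor
  · intro h j S hS
    rw [← key j S hS, h j]
  · intro h j
    exact Measure.ext fun S hS => (key j S hS).trans (h j S hS)

/-- The square root of the average of `f ^ 2` over the permutations of the particles. -/
noncomputable def symmetrize (f : Config N → ℝ) (x : Config N) : ℝ :=
  √((Nat.factorial N : ℝ)⁻¹ * ∑ σ : Equiv.Perm (Fin N), f (fun j => x (σ j)) ^ 2)

theorem symmetrize_perm (f : Config N → ℝ) (τ : Equiv.Perm (Fin N)) (x : Config N) :
    symmetrize f (fun j => x (τ j)) = symmetrize f x := by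
  unfold symmetrize
  congr 2
  exact Fintype.sum_equiv (Equiv.mulLeft τ) _ _ fun σ => rfl

theorem measurable_symmetrize {f : Config N → ℝ} (hf : Measurable f) :
    Measurable (symmetrize f) := by
  refine ((Finset.measurable_fun_sum _ fun σ _ => ?_).const_mul _).sqrt
  exact (hf.comp (measurePreserving_perm σ).measurable).pow_const 2

theorem ofReal_factorial_inv :
    ENNReal.ofReal ((Nat.factorial N : ℝ)⁻¹) = (Nat.factorial N : ℝ≥0∞)⁻¹ := by
  rw [ENNReal.ofReal_inv_of_pos (by exact_mod_cast Nat.factorial_pos N), ENNReal.ofReal_natCast]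

theorem enorm_symmetrize_sq (f : Config N → ℝ) (x : Config N) :
    ‖symmetrize f x‖ₑ ^ 2
      = (Nat.factorial N : ℝ≥0∞)⁻¹ * ∑ σ : Equiv.Perm (Fin N), ‖f (fun j => x (σ j))‖ₑ ^ 2 := by
  rw [Real.enorm_sq_eq_ofReal_sq, symmetrize,
    Real.sq_sqrt (mul_nonneg (by positivity) (Finset.sum_nonneg fun _ _ => sq_nonneg _)),
    ENNReal.ofReal_mul (by positivity), ofReal_factorial_inv,
    ENNReal.ofReal_sum_of_nonneg fun _ _ => sq_nonneg _]
  simp only [Real.enorm_sq_eq_ofReal_sq]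

theorem factorial_inv_mul_sum_perm (c : ℝ≥0∞) :
    (Nat.factorial N : ℝ≥0∞)⁻¹ * ∑ _σ : Equiv.Perm (Fin N), c = c := by
  rw [Finset.sum_const, Finset.card_univ, Fintype.card_perm, Fintype.card_fin, nsmul_eq_mul,
    ← mul_assoc, ENNReal.inv_mul_cancel (by exact_mod_cast (Nat.factorial_pos N).ne')
      (ENNReal.natCast_ne_top _), one_mul]

theorem lintegral_mul_symmetrize {f : Config N → ℝ} (hf : Measurable f) {V : Config N → ℝ≥0∞}
    (hV : Measurable V) {I : ℝ≥0∞}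
    (h : ∀ σ : Equiv.Perm (Fin N), ∫⁻ x, V (fun j => x (σ j)) * ‖f x‖ₑ ^ 2 = I) :
    ∫⁻ x, V x * ‖symmetrize f x‖ₑ ^ 2 = I := by
  have hm : ∀ σ : Equiv.Perm (Fin N), Measurable fun x : Config N =>
      V x * ‖f (fun j => x (σ j))‖ₑ ^ 2 := fun σ =>
    hV.mul ((hf.comp (measurePreserving_perm σ).measurable).enorm.pow_const 2)
  have h1 : ∀ x, V x * ‖symmetrize f x‖ₑ ^ 2 = (Nat.factorial N : ℝ≥0∞)⁻¹
      * ∑ σ : Equiv.Perm (Fin N), V x * ‖f (fun j => x (σ j))‖ₑ ^ 2 := fun x => by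
    rw [enorm_symmetrize_sq, mul_left_comm, Finset.mul_sum]
  simp only [h1]
  rw [lintegral_const_mul _ (Finset.measurable_fun_sum _ fun σ _ => hm σ),
    lintegral_finsetSum _ fun σ _ => hm σ]
  rw [← factorial_inv_mul_sum_perm (N := N) I]
  congr 1
  refine Finset.sum_congr rfl fun σ _ => ?_
  have h2 : Measurable fun x : Config N => V (fun j => x (σ⁻¹ j)) * ‖f x‖ₑ ^ 2 :=
    (hV.comp (measurePreserving_perm σ⁻¹).measurable).mul (hf.enorm.pow_const 2)
  rw [← h σ⁻¹, ← (measurePreserving_perm σ).lintegral_comp h2]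
  simp

theorem coordVec_perm (σ : Equiv.Perm (Fin N)) (j : Fin N) (k : Fin 3) :
    (fun l => coordVec j k (σ l)) = coordVec (σ⁻¹ j) k := by
  funext l
  by_cases h : σ l = j
  · subst h
    simp [coordVec]
  · have h' : l ≠ σ⁻¹ j := fun h' => h (by rw [h']; simp)
    rw [coordVec, coordVec, Pi.single_eq_of_ne h, Pi.single_eq_of_ne h']

/-- Symmetrization averages the bounds on translations over the particles. -/
theorem lintegral_symmetrize_translate_le {f : Config N → ℝ} (hf : Measurable f)
    {C : Fin N → Fin 3 → ℝ≥0∞} {t : ℝ} (h : ∀ j k,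
      ∫⁻ x, ‖f (x + t • coordVec j k) - f x‖ₑ ^ 2 ≤ ENNReal.ofReal (t ^ 2) * C j k)
    (j : Fin N) (k : Fin 3) :
    ∫⁻ x, ‖symmetrize f (x + t • coordVec j k) - symmetrize f x‖ₑ ^ 2
      ≤ ENNReal.ofReal (t ^ 2)
        * ((Nat.factorial N : ℝ≥0∞)⁻¹ * ∑ σ : Equiv.Perm (Fin N), C (σ⁻¹ j) k) := by
  let D : Equiv.Perm (Fin N) → Config N → ℝ≥0∞ := fun σ x =>
    ‖f (x + t • coordVec (σ⁻¹ j) k) - f x‖ₑ ^ 2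
  have hD : ∀ σ, Measurable (D σ) := fun σ =>
    ((hf.comp (measurable_id.add_const _)).sub hf).enorm.pow_const 2
  have h1 : ∀ x, ‖symmetrize f (x + t • coordVec j k) - symmetrize f x‖ₑ ^ 2
      ≤ (Nat.factorial N : ℝ≥0∞)⁻¹ * ∑ σ : Equiv.Perm (Fin N), D σ (fun l => x (σ l)) := by
    intro x
    rw [Real.enorm_sq_eq_ofReal_sq, ← ofReal_factorial_inv]
    simp only [D, Real.enorm_sq_eq_ofReal_sq]
    rw [← ENNReal.ofReal_sum_of_nonneg fun _ _ => sq_nonneg _,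
      ← ENNReal.ofReal_mul (by positivity)]
    apply ENNReal.ofReal_le_ofReal
    refine (sq_sqrt_mul_sum_sub_le (by positivity) _ _).trans (le_of_eq ?_)
    congr 1
    refine Finset.sum_congr rfl fun σ _ => ?_
    rw [← coordVec_perm]
    rfl
  refine (lintegral_mono h1).trans ?_
  have hDσ : ∀ σ : Equiv.Perm (Fin N), Measurable fun x : Config N => D σ (fun l => x (σ l)) :=
    fun σ => (hD σ).comp (measurePreserving_perm σ).measurable
  rw [lintegral_const_mul _ (Finset.measurable_fun_sum _ fun σ _ => hDσ σ),
    lintegral_finsetSum _ fun σ _ => hDσ σ, mul_left_comm]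
  refine mul_le_mul' le_rfl ?_
  rw [Finset.mul_sum]
  refine Finset.sum_le_sum fun σ _ => ?_
  exact ((measurePreserving_perm σ).lintegral_comp (hD σ)).le.trans (h _ _)

theorem sum_average_perm (C : Fin N → Fin 3 → ℝ≥0∞) :
    ∑ j, ∑ k, (Nat.factorial N : ℝ≥0∞)⁻¹ * ∑ σ : Equiv.Perm (Fin N), C (σ⁻¹ j) k
      = ∑ j, ∑ k, C j k := by
  simp only [← Finset.mul_sum]
  rw [← factorial_inv_mul_sum_perm (N := N) (∑ j, ∑ k, C j k)]
  congr 1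
  calc ∑ j, ∑ k, ∑ σ : Equiv.Perm (Fin N), C (σ⁻¹ j) k
      = ∑ σ : Equiv.Perm (Fin N), ∑ j, ∑ k, C (σ⁻¹ j) k := by
        rw [Finset.sum_congr rfl fun j _ => Finset.sum_comm, Finset.sum_comm]
    _ = _ := Finset.sum_congr rfl fun σ _ => Equiv.sum_comp σ⁻¹ fun j => ∑ k, C j k

/-- A state with the one-particle marginals of an admissible state and with translation bounds
becomes admissible after symmetrization; this raises neither the bound on the kinetic energy nor
the expectation of a permutation invariant observable. -/
theorem isAdmissible_symmetrize {ρ : Measure Space} {ψ : Config N → ℂ} (hψ : IsAdmissible ρ ψ)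
    {f : Config N → ℝ} (hf : Measurable f) (hf2 : ∫⁻ x, ‖f x‖ₑ ^ 2 ≠ ⊤)
    (hmarg : ∀ (j : Fin N) (S : Set Space), MeasurableSet S →
      ∫⁻ x : Config N, S.indicator 1 (x j) * ‖f x‖ₑ ^ 2
        = ∫⁻ x : Config N, S.indicator 1 (x j) * ‖ψ x‖ₑ ^ 2)
    {C : Fin N → Fin 3 → ℝ≥0∞} (hC : ∀ j k, C j k ≠ ⊤) {δ : ℝ} (hδ : 0 < δ)
    (h : ∀ j k t, |t| < δ → ∫⁻ x, ‖f (x + t • coordVec j k) - f x‖ₑ ^ 2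
      ≤ ENNReal.ofReal (t ^ 2) * C j k) :
    IsAdmissible ρ (fun x => (symmetrize f x : ℂ)) ∧
      kineticEnergy (fun x => (symmetrize f x : ℂ)) ≤ ∑ j, ∑ k, C j k := by
  have hs := measurable_symmetrize hf
  have henorm : ∀ x, ‖(symmetrize f x : ℂ)‖ₑ = ‖symmetrize f x‖ₑ := fun x => by
    rw [← ofReal_norm, ← ofReal_norm, Complex.norm_real]
  have hs2 : ∫⁻ x, ‖symmetrize f x‖ₑ ^ 2 = ∫⁻ x, ‖f x‖ₑ ^ 2 := by
    simpa using lintegral_mul_symmetrize (V := fun _ => 1) hf measurable_const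
      (I := ∫⁻ x, ‖f x‖ₑ ^ 2) (fun σ => by simp)
  have hmem : MemLp (symmetrize f) 2 :=
    (memLp_two_iff_lintegral_sq hs.aestronglyMeasurable).2 (by rwa [hs2])
  have hCs : ∀ j k, (Nat.factorial N : ℝ≥0∞)⁻¹ * ∑ σ : Equiv.Perm (Fin N), C (σ⁻¹ j) k ≠ ⊤ :=
    fun j k => ENNReal.mul_ne_top
      (ENNReal.inv_ne_top.2 (by exact_mod_cast (Nat.factorial_pos N).ne'))
      (ENNReal.sum_ne_top.2 fun σ _ => hC _ _)
  obtain ⟨h1, h2⟩ := memH1_of_translate hmem _ hCs hδ fun j k t ht =>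
    lintegral_symmetrize_translate_le hf (fun j k => h j k t ht) j k
  rw [sum_average_perm] at h2
  refine ⟨⟨h1, fun σ => ?_, ?_⟩, h2⟩
  · exact Eventually.of_forall fun x => by simp only [symmetrize_perm]
  · have hψd := hasDensity_iff.1 hψ.2.2
    rw [hasDensity_iff]
    intro j S hS
    rw [← hψd j S hS]
    congr 1
    simp only [henorm]
    refine lintegral_mul_symmetrize (V := fun x => S.indicator 1 (x j)) hf
      ((measurable_one.indicator hS).comp (measurable_pi_apply j)) fun σ => ?_
    rw [hmarg (σ j) S hS]
    have hN : (N : ℝ≥0∞) ≠ 0 := by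
      have := j.pos
      exact_mod_cast this.ne'
    rw [← ENNReal.mul_right_inj hN (ENNReal.natCast_ne_top N), hψd j S hS, hψd (σ j) S hS]

end LevyLieb

namespace LevyLieb

/-! ### The pair interaction under an exchange -/

variable {N : ℕ}

/-- The interaction summed over ordered pairs of distinct particles. Unlike `pairInteraction` it is
invariant under permutations of the particles even if `c` is not symmetric. -/
noncomputable def symInteraction (c : Space → Space → ℝ≥0∞) (x : Config N) : ℝ≥0∞ :=
  ∑ i : Fin N, ∑ j ∈ Finset.univ.erase i, c (x i) (x j)

theorem symInteraction_perm (c : Space → Space → ℝ≥0∞) (σ : Equiv.Perm (Fin N)) (x : Config N) :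
    symInteraction c (fun i => x (σ i)) = symInteraction c x := by
  unfold symInteraction
  refine Fintype.sum_equiv σ _ _ fun i => ?_
  refine Finset.sum_equiv σ (fun j => ?_) (fun j _ => rfl)
  simp

theorem pairInteraction_add_rev (c : Space → Space → ℝ≥0∞) (x : Config N) :
    pairInteraction c x + pairInteraction c (fun i => x (Fin.revPerm i)) = symInteraction c x := by
  have h1 : pairInteraction c (fun i => x (Fin.revPerm i))
      = ∑ i : Fin N, ∑ j ∈ Finset.Iio i, c (x i) (x j) := by
    unfold pairInteraction
    refine Fintype.sum_equiv Fin.revPerm _ _ fun i => ?_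
    refine Finset.sum_equiv Fin.revPerm (fun j => ?_) (fun j _ => rfl)
    simp
  rw [h1, pairInteraction, symInteraction, ← Finset.sum_add_distrib]
  refine Finset.sum_congr rfl fun i _ => ?_
  rw [← Finset.sum_union (Finset.disjoint_left.2 fun j h1 h2 => by
    rw [Finset.mem_Ioi] at h1; rw [Finset.mem_Iio] at h2; exact absurd h1 h2.asymm)]
  refine Finset.sum_congr ?_ fun _ _ => rfl
  ext j
  simp [lt_or_lt_iff_ne, eq_comm]

theorem measurable_pairInteraction {c : Space → Space → ℝ≥0∞}
    (hc : Measurable fun p : Space × Space => c p.1 p.2) :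
    Measurable (pairInteraction (N := N) c) :=
  Finset.measurable_fun_sum _ fun i _ => Finset.measurable_fun_sum _ fun j _ =>
    hc.comp (g := fun p : Space × Space => c p.1 p.2) (f := fun x : Config N => (x i, x j))
      ((measurable_pi_apply i).prodMk (measurable_pi_apply j))

theorem measurable_symInteraction {c : Space → Space → ℝ≥0∞}
    (hc : Measurable fun p : Space × Space => c p.1 p.2) :
    Measurable (symInteraction (N := N) c) :=
  Finset.measurable_fun_sum _ fun i _ => Finset.measurable_fun_sum _ fun j _ =>
    hc.comp (g := fun p : Space × Space => c p.1 p.2) (f := fun x : Config N => (x i, x j))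
      ((measurable_pi_apply i).prodMk (measurable_pi_apply j))

theorem IsBosonic.lintegral_perm {ψ : Config N → ℂ} (hψ : IsBosonic ψ)
    (hm : AEStronglyMeasurable ψ volume) (σ : Equiv.Perm (Fin N))
    {V : Config N → ℝ≥0∞} (hV : Measurable V) :
    ∫⁻ x, V (fun i => x (σ i)) * ‖ψ x‖ₑ ^ 2 = ∫⁻ x, V x * ‖ψ x‖ₑ ^ 2 := by
  have hs := measurePreserving_perm σ
  have hm2 : AEMeasurable (fun x => V x * ‖ψ x‖ₑ ^ 2) volume :=
    hV.aemeasurable.mul (hm.enorm.pow_const 2)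
  rw [← hs.map_eq] at hm2
  have h1 := lintegral_map' hm2 hs.measurable.aemeasurable
  rw [hs.map_eq] at h1
  rw [h1]
  refine lintegral_congr_ae ?_
  filter_upwards [hψ σ] with x hx
  simp only [hx]

theorem IsBosonic.two_mul_lintegral_pairInteraction {ψ : Config N → ℂ} (hψ : IsBosonic ψ)
    (hm : AEStronglyMeasurable ψ volume) {c : Space → Space → ℝ≥0∞}
    (hc : Measurable fun p : Space × Space => c p.1 p.2) :
    2 * ∫⁻ x, pairInteraction c x * ‖ψ x‖ₑ ^ 2 = ∫⁻ x, symInteraction c x * ‖ψ x‖ₑ ^ 2 := by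
  have hv := measurable_pairInteraction (N := N) hc
  simp only [← pairInteraction_add_rev, add_mul]
  have hvm : AEMeasurable (fun x => pairInteraction c x * ‖ψ x‖ₑ ^ 2) volume :=
    hv.aemeasurable.mul (hm.enorm.pow_const 2)
  rw [lintegral_add_left' hvm, hψ.lintegral_perm hm Fin.revPerm hv, two_mul]

/-- The interaction of a particle at `w` with the particles of `x` other than `i`. -/
noncomputable def particleInteraction (c : Space → Space → ℝ≥0∞) (i : Fin N) (w : Space)
    (x : Config N) : ℝ≥0∞ :=
  ∑ j ∈ Finset.univ.erase i, (c w (x j) + c (x j) w)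

theorem symInteraction_update (c : Space → Space → ℝ≥0∞) (i : Fin N) (x : Config N) :
    ∃ R : ℝ≥0∞, ∀ w,
      symInteraction c (Function.update x i w) = particleInteraction c i w x + R := by
  refine ⟨∑ j ∈ Finset.univ.erase i, ∑ k ∈ (Finset.univ.erase j).erase i, c (x j) (x k),
    fun w => ?_⟩
  unfold symInteraction particleInteraction
  rw [← Finset.add_sum_erase _ _ (Finset.mem_univ i), Finset.sum_add_distrib, add_assoc]
  refine congrArg₂ (fun a b : ℝ≥0∞ => a + b) ?_ ?_
  · refine Finset.sum_congr rfl fun j hj => ?_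
    rw [Function.update_self, Function.update_of_ne (Finset.ne_of_mem_erase hj)]
  · rw [← Finset.sum_add_distrib]
    refine Finset.sum_congr rfl fun j hj => ?_
    have hj' := Finset.ne_of_mem_erase hj
    rw [← Finset.add_sum_erase _ _ (Finset.mem_erase.2 ⟨hj'.symm, Finset.mem_univ i⟩)]
    rw [Function.update_self, Function.update_of_ne hj']
    refine congrArg₂ (fun a b : ℝ≥0∞ => a + b) rfl (Finset.sum_congr rfl fun k hk => ?_)
    rw [Function.update_of_ne (Finset.ne_of_mem_erase hk)]

theorem IsRepulsiveCost.particleInteraction_le {c : Space → Space → ℝ≥0∞} {m M : ℝ → ℝ}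
    (h : IsRepulsiveCost c m M) {d : ℝ} (hd : 0 < d) (i : Fin N) {w : Space} {x : Config N}
    (hx : ∀ j, j ≠ i → d ≤ ‖w - x j‖) :
    particleInteraction c i w x ≤ 2 * (N - 1 : ℕ) * ENNReal.ofReal (M d) := by
  have hb : ∀ u v : Space, d ≤ ‖u - v‖ → c u v ≤ ENNReal.ofReal (M d) := by
    intro u v huv
    have hne : u ≠ v := by
      rintro rfl
      simp only [sub_self, norm_zero] at huv
      linarith
    exact (h.le_upper u v hne).trans
      (ENNReal.ofReal_le_ofReal (h.upper_antitone hd (hd.trans_le huv) huv))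
  refine (Finset.sum_le_card_nsmul _ _ (2 * ENNReal.ofReal (M d)) fun j hj => ?_).trans ?_
  · have hj' := hx j (Finset.ne_of_mem_erase hj)
    rw [two_mul]
    exact add_le_add (hb _ _ hj') (hb _ _ (by rwa [norm_sub_rev]))
  · rw [Finset.card_erase_of_mem (Finset.mem_univ i), Finset.card_univ, Fintype.card_fin,
      nsmul_eq_mul]
    exact le_of_eq (by ring)

theorem IsRepulsiveCost.le_particleInteraction {c : Space → Space → ℝ≥0∞} {m M : ℝ → ℝ}
    (h : IsRepulsiveCost c m M) {d : ℝ} {i k : Fin N} (hk : k ≠ i) {x : Config N}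
    (hne : x i ≠ x k) (hx : ‖x i - x k‖ ≤ d) :
    2 * ENNReal.ofReal (m d) ≤ particleInteraction c i (x i) x := by
  have hpos : 0 < ‖x i - x k‖ := norm_pos_iff.2 (sub_ne_zero.2 hne)
  have hm : ENNReal.ofReal (m d) ≤ ENNReal.ofReal (m ‖x i - x k‖) :=
    ENNReal.ofReal_le_ofReal (h.lower_antitone hpos (hpos.trans_le hx) hx)
  have h1 := hm.trans (h.lower_le _ _ hne)
  have h2 := h.lower_le _ _ hne.symm
  rw [norm_sub_rev] at h2
  rw [two_mul]
  refine (add_le_add h1 (hm.trans h2)).trans ?_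
  exact Finset.single_le_sum (f := fun j => c (x i) (x j) + c (x j) (x i)) (fun _ _ => zero_le)
    (Finset.mem_erase.2 ⟨hk, Finset.mem_univ k⟩)

/-- Exchanging the particle `i` of `z.1`, which has a close neighbour, with that of `z.2` lowers
the interaction if both particles arrive far from the others. -/
theorem IsRepulsiveCost.symInteraction_exchange_le {c : Space → Space → ℝ≥0∞} {m M : ℝ → ℝ}
    (h : IsRepulsiveCost c m M) {d s : ℝ} (hs : 0 < s) {i k : Fin N} (hk : k ≠ i)
    {z : Config N × Config N} (hne : z.1 i ≠ z.1 k) (hx : ‖z.1 i - z.1 k‖ ≤ d)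
    (h1 : ∀ j, j ≠ i → s ≤ ‖z.2 i - z.1 j‖) (h2 : ∀ j, j ≠ i → s ≤ ‖z.1 i - z.2 j‖) :
    symInteraction c (exchange i z).1 + symInteraction c (exchange i z).2
        + 2 * ENNReal.ofReal (m d)
      ≤ symInteraction c z.1 + symInteraction c z.2
        + 4 * (N - 1 : ℕ) * ENNReal.ofReal (M s) := by
  obtain ⟨R1, hR1⟩ := symInteraction_update c i z.1
  obtain ⟨R2, hR2⟩ := symInteraction_update c i z.2
  have e1 := hR1 (z.1 i)
  have e2 := hR2 (z.2 i)
  rw [Function.update_eq_self] at e1 e2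
  simp only [exchange]
  rw [hR1, hR2, e1, e2]
  calc _ ≤ (2 * (N - 1 : ℕ) * ENNReal.ofReal (M s) + R1)
        + (2 * (N - 1 : ℕ) * ENNReal.ofReal (M s) + R2) + particleInteraction c i (z.1 i) z.1 := by
        gcongr
        · exact h.particleInteraction_le hs i h1
        · exact h.particleInteraction_le hs i h2
        · exact h.le_particleInteraction hk hne hx
    _ = (particleInteraction c i (z.1 i) z.1 + R1) + (0 + R2)
        + 4 * (N - 1 : ℕ) * ENNReal.ofReal (M s) := by ring
    _ ≤ _ := by
        gcongr
        exact zero_le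

/-- Coincidence of two given particles has measure zero. -/
theorem volume_coincidence {i k : Fin N} (hk : k ≠ i) :
    volume {x : Config N | x i = x k} = 0 := by
  let L : Config N →ₗ[ℝ] Space := (LinearMap.proj i : Config N →ₗ[ℝ] Space) - LinearMap.proj k
  have hL : {x : Config N | x i = x k} = (LinearMap.ker L : Set (Config N)) := by
    ext x
    simp [L, sub_eq_zero]
  rw [hL]
  refine Measure.addHaar_submodule volume _ fun htop => ?_
  have h1 : coordVec i 0 ∈ LinearMap.ker L := by rw [htop]; trivial
  have h2 : L (coordVec i 0) = EuclideanSpace.single 0 1 := by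
    simp [L, coordVec, Pi.single_eq_of_ne hk]
  rw [LinearMap.mem_ker, h2] at h1
  have := congrArg norm h1
  simp at this

/-! ### Minimality tested against an exchange -/

theorem IsRepulsiveCost.lintegral_symInteraction_exchange_le {c : Space → Space → ℝ≥0∞}
    {m M : ℝ → ℝ} (h : IsRepulsiveCost c m M) {d s : ℝ} (hs : 0 < s) {i k : Fin N} (hk : k ≠ i)
    {r : Config N → ℝ} {b : Config N × Config N → ℝ} (hr : Measurable r) (hb : Measurable b)
    (hsel : ∀ z, b z ≠ 0 → ‖z.1 i - z.1 k‖ ≤ d ∧ (∀ j, j ≠ i → s ≤ ‖z.2 i - z.1 j‖) ∧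
      ∀ j, j ≠ i → s ≤ ‖z.1 i - z.2 j‖) :
    (∫⁻ z : Config N × Config N,
        (symInteraction c (exchange i z).1 + symInteraction c (exchange i z).2)
          * ‖pairAmplitude r b z‖ₑ ^ 2)
        + 2 * ENNReal.ofReal (m d) * ∫⁻ z, ‖pairAmplitude r b z‖ₑ ^ 2
      ≤ (∫⁻ z : Config N × Config N,
          (symInteraction c z.1 + symInteraction c z.2) * ‖pairAmplitude r b z‖ₑ ^ 2)
        + 4 * (N - 1 : ℕ) * ENNReal.ofReal (M s) * ∫⁻ z, ‖pairAmplitude r b z‖ₑ ^ 2 := by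
  have hG : Measurable fun z => ‖pairAmplitude r b z‖ₑ ^ 2 :=
    (measurable_pairAmplitude hr hb).enorm.pow_const 2
  rw [← lintegral_const_mul _ hG, ← lintegral_const_mul _ hG,
    ← lintegral_add_right _ (hG.const_mul _), ← lintegral_add_right _ (hG.const_mul _)]
  refine lintegral_mono_ae ?_
  have hnull : ∀ᵐ x : Config N, x i ≠ x k := by
    rw [ae_iff]
    simpa using volume_coincidence hk
  have hnull2 : ∀ᵐ z : Config N × Config N, z.1 i ≠ z.1 k :=
    Measure.quasiMeasurePreserving_fst.ae hnull
  filter_upwards [hnull2] with z hz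
  rw [← add_mul, ← add_mul]
  by_cases hbz : b z = 0
  · simp [pairAmplitude, hbz]
  · obtain ⟨h0, h1, h2⟩ := hsel z hbz
    exact mul_le_mul' (h.symInteraction_exchange_le hs hk hz h0 h1 h2) le_rfl

theorem lintegral_norm_translate_le {ψ : Config N → ℂ} {r : Config N → ℝ}
    (hrψ : ∀ᵐ x, r x = ‖ψ x‖) (v : Config N) :
    ∫⁻ x, ‖r (x + v) - r x‖ₑ ^ 2 ≤ ∫⁻ x, ‖ψ (x + v) - ψ x‖ₑ ^ 2 := by
  have hv : ∀ᵐ x, r (x + v) = ‖ψ (x + v)‖ :=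
    (measurePreserving_add_right volume v).quasiMeasurePreserving.ae hrψ
  refine lintegral_mono_ae ?_
  filter_upwards [hrψ, hv] with x h1 h2
  rw [h1, h2]
  refine pow_le_pow_left₀ zero_le ?_ 2
  rw [← ofReal_norm, ← ofReal_norm]
  exact ENNReal.ofReal_le_ofReal (by simpa using abs_norm_sub_norm_le (ψ (x + v)) (ψ x))

/-- The minimality of `ψ`, tested against the symmetrized exchanged state: the gain of interaction
energy is at most the localization error. -/
theorem IsMinimizer.exchange_le {c : Space → Space → ℝ≥0∞} {m M : ℝ → ℝ}
    (h : IsRepulsiveCost c m M) {ρ : Measure Space} {ε : ℝ} {ψ : Config N → ℂ}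
    (hmin : IsMinimizer ε c ρ ψ) {r : Config N → ℝ} (hr : Measurable r)
    (hrψ : ∀ᵐ x, r x = ‖ψ x‖) (hr1 : ∫⁻ x, ‖r x‖ₑ ^ 2 = 1)
    {d s : ℝ} (hs : 0 < s) {i k : Fin N} (hk : k ≠ i) {b : Config N × Config N → ℝ}
    (hb : Measurable b) (hb4 : ∀ z, b z ^ 2 ≤ 1 / 4)
    (hsel : ∀ z, b z ≠ 0 → ‖z.1 i - z.1 k‖ ≤ d ∧ (∀ j, j ≠ i → s ≤ ‖z.2 i - z.1 j‖) ∧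
      ∀ j, j ≠ i → s ≤ ‖z.1 i - z.2 j‖)
    {W : Fin N → Config N × Config N → ℝ} (hWm : ∀ j, Measurable (W j)) (hW0 : ∀ j z, 0 ≤ W j z)
    (hWtop : ∀ j, ∫⁻ z : Config N × Config N,
      ENNReal.ofReal (W j z) * (‖r z.1‖ₑ ^ 2 * ‖r z.2‖ₑ ^ 2) ≠ ⊤)
    {δ : ℝ} (hδ : 0 < δ) (hW : ∀ (j : Fin N) (l : Fin 3) z t, |t| < δ →
      2 * ((b (z + (t • coordVec j l, 0)) - b z) ^ 2
        + (b (z + (t • coordVec j l, 0)).swap - b z.swap) ^ 2) ≤ t ^ 2 * W j z) :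
    2 * ENNReal.ofReal (m d) * ∫⁻ z, ‖pairAmplitude r b z‖ₑ ^ 2
      ≤ 2 * ENNReal.ofReal ε * (∑ j : Fin N, ∑ _l : Fin 3, ∫⁻ z : Config N × Config N,
          ENNReal.ofReal (W j z) * (‖r z.1‖ₑ ^ 2 * ‖r z.2‖ₑ ^ 2))
        + 4 * (N - 1 : ℕ) * ENNReal.ofReal (M s) * ∫⁻ z, ‖pairAmplitude r b z‖ₑ ^ 2 := by
  obtain ⟨hadm, hfin, hle⟩ := hmin
  have hψH := hadm.1
  have hψm := hψH.1.1
  have hsq : ∀ᵐ x, ‖ψ x‖ₑ ^ 2 = ‖r x‖ₑ ^ 2 := by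
    filter_upwards [hrψ] with x hx
    rw [hx, enorm_norm]
  have hVψ : ∀ V : Config N → ℝ≥0∞, ∫⁻ x, V x * ‖ψ x‖ₑ ^ 2 = ∫⁻ x, V x * ‖r x‖ₑ ^ 2 := fun V =>
    lintegral_congr_ae (hsq.mono fun x hx => by simp only [hx])
  set f := exchangeState i r b with hf
  have hfm : Measurable f := measurable_exchangeState hr hb
  have hfsq := exchangeState_sq_ae_eq (i := i) hr hb hr1 hb4
  have hVf : ∀ V : Config N → ℝ≥0∞,
      ∫⁻ x, V x * ‖f x‖ₑ ^ 2 = ∫⁻ x, V x * exchangeDensity i r b x := fun V =>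
    lintegral_congr_ae (hfsq.mono fun x hx => by simp only [hf, hx])
  have hf1 : ∫⁻ x, ‖f x‖ₑ ^ 2 = 1 := by
    rw [← lintegral_exchangeDensity (i := i) hr hb hr1 hb4]
    exact lintegral_congr_ae hfsq
  let C : Fin N → Fin 3 → ℝ≥0∞ := fun j l => (∫⁻ x, ‖weakPartial ψ j l x‖ₑ ^ 2)
    + ∫⁻ z : Config N × Config N, ENNReal.ofReal (W j z) * (‖r z.1‖ₑ ^ 2 * ‖r z.2‖ₑ ^ 2)
  obtain ⟨hφ, hφT⟩ := isAdmissible_symmetrize hadm hfm (by rw [hf1]; exact ENNReal.one_ne_top)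
    (fun j S hS => by
      rw [hVf (fun x => S.indicator 1 (x j)), hVψ (fun x => S.indicator 1 (x j)),
        lintegral_indicator_mul_exchangeDensity hr hb hr1 hb4 j hS]) (C := C)
    (fun j l => ENNReal.add_ne_top.2 ⟨hψH.lintegral_weakPartial_ne_top j l, hWtop j⟩) hδ
    (fun j l t ht => by
      refine (lintegral_exchangeState_translate_le hr hb hr1 hb4 j l (hWm j) (hW0 j)
        (hW j l) ht).trans ?_
      rw [mul_add]
      gcongr
      exact (lintegral_norm_translate_le hrψ _).trans (hψH.lintegral_translate_le j l t))
  set φ : Config N → ℂ := fun x => (symmetrize f x : ℂ) with hφdef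
  set T := kineticEnergy ψ with hT
  set Ws := ∑ j : Fin N, ∑ _l : Fin 3, ∫⁻ z : Config N × Config N,
    ENNReal.ofReal (W j z) * (‖r z.1‖ₑ ^ 2 * ‖r z.2‖ₑ ^ 2) with hWs
  have hCsum : ∑ j, ∑ l, C j l = T + Ws := by
    rw [hT, hψH.kineticEnergy_eq, hWs, ← Finset.sum_add_distrib]
    exact Finset.sum_congr rfl fun j _ => Finset.sum_add_distrib
  rw [hCsum] at hφT
  have hsm := measurable_symInteraction (N := N) h.measurable
  have hIψ := hadm.2.1.two_mul_lintegral_pairInteraction hψm h.measurable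
  have hIφ := hφ.2.1.two_mul_lintegral_pairInteraction hφ.1.1.1 h.measurable
  have hφr : ∫⁻ x, symInteraction c x * ‖φ x‖ₑ ^ 2
      = ∫⁻ x, symInteraction c x * exchangeDensity i r b x := by
    have henorm : ∀ x, ‖φ x‖ₑ = ‖symmetrize f x‖ₑ := fun x => by
      rw [← ofReal_norm, ← ofReal_norm, Complex.norm_real]
    simp only [henorm]
    refine lintegral_mul_symmetrize hfm hsm fun σ => ?_
    simp only [symInteraction_perm]
    exact hVf _
  rw [hφr] at hIφ
  rw [hVψ (symInteraction c)] at hIψ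
  have hbal := lintegral_mul_exchangeDensity (i := i) hr hb hr1 hb4 hsm
  have hex := h.lintegral_symInteraction_exchange_le hs hk hr hb hsel
  have hE := hle φ hφ
  have hTfin : ENNReal.ofReal ε * T ≠ ⊤ := (ENNReal.add_ne_top.1 hfin).1
  have hIfin : ∫⁻ x, pairInteraction c x * ‖ψ x‖ₑ ^ 2 ≠ ⊤ := (ENNReal.add_ne_top.1 hfin).2
  have hg := lintegral_pairAmplitude_ne_top hr hr1 hb4
  set g := ∫⁻ z, ‖pairAmplitude r b z‖ₑ ^ 2 with hgdef
  set S := ∫⁻ x, symInteraction c x * ‖r x‖ₑ ^ 2 with hS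
  set S' := ∫⁻ x, symInteraction c x * exchangeDensity i r b x with hS'
  have hSfin : S ≠ ⊤ := by rw [← hIψ]; exact ENNReal.mul_ne_top (by norm_num) hIfin
  set X := ∫⁻ z : Config N × Config N,
    (symInteraction c z.1 + symInteraction c z.2) * ‖pairAmplitude r b z‖ₑ ^ 2 with hX
  have hXfin : X ≠ ⊤ := by
    have hP : Measurable fun x => ‖r x‖ₑ ^ 2 := hr.enorm.pow_const 2
    have hs1 : Measurable fun z : Config N × Config N =>
        symInteraction c z.1 * (‖r z.1‖ₑ ^ 2 * ‖r z.2‖ₑ ^ 2) :=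
      (hsm.comp measurable_fst).mul ((hP.comp measurable_fst).mul (hP.comp measurable_snd))
    have hsw : MeasurePreserving (Prod.swap : Config N × Config N → _) volume volume :=
      Measure.measurePreserving_swap
    have e1 := lintegral_fst_mul_of_mass_one hr hr1 hsm
    have e2 := hsw.lintegral_comp hs1
    rw [e1] at e2
    refine ne_top_of_le_ne_top (ENNReal.add_ne_top.2 ⟨hSfin, hSfin⟩) ?_
    calc X ≤ ∫⁻ z : Config N × Config N, (symInteraction c z.1 * (‖r z.1‖ₑ ^ 2 * ‖r z.2‖ₑ ^ 2)
          + symInteraction c z.swap.1 * (‖r z.swap.1‖ₑ ^ 2 * ‖r z.swap.2‖ₑ ^ 2)) := by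
          refine lintegral_mono fun z => ?_
          simp only [Prod.fst_swap, Prod.snd_swap]
          rw [mul_comm (‖r z.2‖ₑ ^ 2), ← add_mul]
          refine mul_le_mul' le_rfl ?_
          rw [← enorm_sq_remainder_add hb4 z, add_right_comm]
          exact le_add_self
      _ = S + S := by rw [lintegral_add_left hs1, e1, e2]
  have hB : 4 * (N - 1 : ℕ) * ENNReal.ofReal (M s) * g ≠ ⊤ :=
    ENNReal.mul_ne_top (ENNReal.mul_ne_top (ENNReal.mul_ne_top (by norm_num)
      (ENNReal.natCast_ne_top _)) ENNReal.ofReal_ne_top) hg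
  -- the exchange lowers the interaction
  have k1 : S' + 2 * ENNReal.ofReal (m d) * g
      ≤ S + 4 * (N - 1 : ℕ) * ENNReal.ofReal (M s) * g := by
    rw [← ENNReal.add_le_add_iff_right hXfin]
    calc _ = (S' + X) + 2 * ENNReal.ofReal (m d) * g := by ring
      _ ≤ S + (X + 4 * (N - 1 : ℕ) * ENNReal.ofReal (M s) * g) := by
          rw [hbal, add_assoc]
          gcongr
      _ = _ := by ring
  have hS'fin : S' ≠ ⊤ := ne_top_of_le_ne_top (ENNReal.add_ne_top.2 ⟨hSfin, hB⟩)
    (le_self_add.trans k1)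
  -- minimality
  have k2 : S ≤ 2 * ENNReal.ofReal ε * Ws + S' := by
    rw [← hIψ, ← hIφ]
    have h2 : ENNReal.ofReal ε * T + ∫⁻ x, pairInteraction c x * ‖ψ x‖ₑ ^ 2
        ≤ ENNReal.ofReal ε * T
          + (ENNReal.ofReal ε * Ws + ∫⁻ x, pairInteraction c x * ‖φ x‖ₑ ^ 2) := by
      rw [← add_assoc, ← mul_add]
      refine hE.trans ?_
      unfold energy
      gcongr
    rw [ENNReal.add_le_add_iff_left hTfin] at h2
    calc _ ≤ _ := mul_le_mul' le_rfl h2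
      _ = _ := by ring
  rw [← ENNReal.add_le_add_iff_left hS'fin]
  refine k1.trans ((add_le_add_left k2 _).trans (le_of_eq ?_))
  ring

end LevyLieb

theorem Real.exp_sub_one_le_of_le_quarter {u : ℝ} (h0 : 0 ≤ u) (h1 : u ≤ 1 / 4) :
    Real.exp u - 1 ≤ 5 / 4 * u := by
  have h := Real.abs_exp_sub_one_sub_id_le (x := u) (by rw [abs_of_nonneg h0]; linarith)
  have h2 := (abs_le.1 h).2
  nlinarith

theorem Real.abs_exp_sub_exp_le {p p' u : ℝ} (h : |p' - p| ≤ u) (hu : u ≤ 1 / 4) :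
    |Real.exp p' - Real.exp p| ≤ 5 / 4 * u * Real.exp p := by
  have hu0 : 0 ≤ u := (abs_nonneg _).trans h
  have hp := Real.exp_pos p
  have e1 : Real.exp p' - Real.exp p = (Real.exp (p' - p) - 1) * Real.exp p := by
    rw [sub_mul, one_mul, ← Real.exp_add, sub_add_cancel]
  rw [e1, abs_mul, abs_of_pos hp]
  refine mul_le_mul_of_nonneg_right ?_ hp.le
  obtain ⟨h1, h2⟩ := abs_le.1 h
  rw [abs_le]
  constructor
  · have := Real.add_one_le_exp (p' - p)
    linarith
  · have := Real.exp_le_exp.2 h2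
    have := Real.exp_sub_one_le_of_le_quarter hu0 hu
    linarith

namespace LevyLieb

/-! ### The weights -/

variable {N : ℕ}

/-- The exponential weight that grows as the particles `i` and `k` approach each other, and is
`1` as soon as their distance is at least `a`. -/
noncomputable def closeWeight (κ a : ℝ) (i k : Fin N) (x : Config N) : ℝ :=
  Real.exp (κ * max 0 (a - ‖x i - x k‖))

/-- The pairs of configurations in which exchanging the particles `i` would bring one of them to
a distance less than `s` from one of its new neighbours. -/
def unseparated (i : Fin N) (s : ℝ) : Set (Config N × Config N) :=
  {z | ∃ j, j ≠ i ∧ (‖z.2 i - z.1 j‖ < s ∨ ‖z.1 i - z.2 j‖ < s)}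

/-- A Lipschitz cutoff that vanishes on `unseparated i s` and is `1` outside
`unseparated i (2 * s)`. -/
noncomputable def separation (i : Fin N) (s : ℝ) (z : Config N × Config N) : ℝ :=
  min 1 (2 / s * Metric.infDist z (unseparated i s))

/-- The amplitude of the selected part of `ψ ⊗ ψ`. The prefactor makes its square at most `1/4`. -/
noncomputable def selection (κ a s : ℝ) (i k : Fin N) (z : Config N × Config N) : ℝ :=
  Real.exp (-(κ * a)) / 2 * ((closeWeight κ a i k z.1 - 1) * separation i s z)

variable {κ a s : ℝ} {i k : Fin N}

theorem continuous_closeWeight : Continuous (closeWeight κ a i k) := by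
  unfold closeWeight
  fun_prop

theorem one_le_closeWeight (hκ : 0 ≤ κ) (x : Config N) : 1 ≤ closeWeight κ a i k x :=
  Real.one_le_exp (mul_nonneg hκ (le_max_left _ _))

theorem closeWeight_le (hκ : 0 ≤ κ) (ha : 0 ≤ a) (x : Config N) :
    closeWeight κ a i k x ≤ Real.exp (κ * a) := by
  refine Real.exp_le_exp.2 (mul_le_mul_of_nonneg_left (max_le ha ?_) hκ)
  linarith [norm_nonneg (x i - x k)]

theorem closeWeight_eq_one {x : Config N} (h : a ≤ ‖x i - x k‖) : closeWeight κ a i k x = 1 := by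
  rw [closeWeight, max_eq_left (by linarith), mul_zero, Real.exp_zero]

theorem closeWeight_translate (hκ : 0 < κ) (hk : k ≠ i) (x : Config N) (j : Fin N) (l : Fin 3)
    {t : ℝ} (ht : |t| ≤ 1 / (4 * κ)) :
    |closeWeight κ a i k (x + t • coordVec j l) - closeWeight κ a i k x|
      ≤ |t| * if j = i ∨ j = k then 5 / 4 * κ * closeWeight κ a i k x else 0 := by
  have e1 : (x + t • coordVec j l) i - (x + t • coordVec j l) k
      = (x i - x k) + t • (coordVec j l i - coordVec j l k) := by
    simp only [Pi.add_apply, Pi.smul_apply, smul_sub]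
    abel
  by_cases hj : j = i ∨ j = k
  · rw [if_pos hj]
    have hn : ‖coordVec j l i - coordVec j l k‖ = 1 := by
      rcases hj with rfl | rfl
      · rw [coordVec, Pi.single_eq_same, Pi.single_eq_of_ne hk]
        simp
      · rw [coordVec, Pi.single_eq_same, Pi.single_eq_of_ne hk.symm]
        simp
    have hd : |κ * max 0 (a - ‖(x + t • coordVec j l) i - (x + t • coordVec j l) k‖)
        - κ * max 0 (a - ‖x i - x k‖)| ≤ κ * |t| := by
      rw [← mul_sub, abs_mul, abs_of_pos hκ]
      refine mul_le_mul_of_nonneg_left ?_ hκ.le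
      rw [max_comm 0, max_comm 0]
      refine (abs_max_sub_max_le_abs _ _ _).trans ?_
      rw [sub_sub_sub_cancel_left, abs_sub_comm, e1]
      refine (abs_norm_sub_norm_le _ _).trans ?_
      rw [add_sub_cancel_left, norm_smul, hn, mul_one, Real.norm_eq_abs]
    have hq : κ * |t| ≤ 1 / 4 := by
      calc κ * |t| ≤ κ * (1 / (4 * κ)) := mul_le_mul_of_nonneg_left ht hκ.le
        _ = 1 / 4 := by field_simp
    refine (Real.abs_exp_sub_exp_le hd hq).trans (le_of_eq ?_)
    rw [closeWeight]
    ring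
  · rw [if_neg hj, mul_zero]
    push Not at hj
    have : coordVec j l i - coordVec j l k = 0 := by
      rw [coordVec, Pi.single_eq_of_ne hj.1.symm, Pi.single_eq_of_ne hj.2.symm, sub_zero]
    rw [this, smul_zero, add_zero] at e1
    rw [closeWeight, closeWeight, e1, sub_self, abs_zero]

theorem unseparated_nonempty (hs : 0 < s) (hk : k ≠ i) : (unseparated i s).Nonempty :=
  ⟨0, k, hk, Or.inl (by simpa using hs)⟩

theorem continuous_separation : Continuous (separation i s) :=
  continuous_const.min (continuous_const.mul (Metric.continuous_infDist_pt _))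

theorem separation_nonneg (hs : 0 < s) (z : Config N × Config N) : 0 ≤ separation i s z :=
  le_min zero_le_one (mul_nonneg (by positivity) Metric.infDist_nonneg)

theorem separation_le_one (z : Config N × Config N) : separation i s z ≤ 1 := min_le_left _ _

theorem separation_eq_zero {z : Config N × Config N} (h : z ∈ unseparated i s) :
    separation i s z = 0 := by
  rw [separation, Metric.infDist_zero_of_mem h, mul_zero, min_eq_right zero_le_one]

theorem separation_eq_one (hs : 0 < s) (hk : k ≠ i) {z : Config N × Config N}
    (h : z ∉ unseparated i (2 * s)) : separation i s z = 1 := by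
  have h1 : s / 2 ≤ Metric.infDist z (unseparated i s) := by
    refine (Metric.le_infDist (unseparated_nonempty hs hk)).2 fun {w} hw => ?_
    have hz1 : ∀ j, ‖z.1 j - w.1 j‖ ≤ dist z w := fun j => by
      rw [← dist_eq_norm]
      exact (dist_le_pi_dist _ _ j).trans (le_max_left _ _)
    have hz2 : ∀ j, ‖z.2 j - w.2 j‖ ≤ dist z w := fun j => by
      rw [← dist_eq_norm]
      exact (dist_le_pi_dist _ _ j).trans (le_max_right _ _)
    obtain ⟨j, hj, hw⟩ := hw
    have hnot : ¬ (‖z.2 i - z.1 j‖ < 2 * s ∨ ‖z.1 i - z.2 j‖ < 2 * s) := fun h' => h ⟨j, hj, h'⟩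
    push Not at hnot
    rcases hw with hw | hw
    · have e : z.2 i - z.1 j = (z.2 i - w.2 i) + (w.2 i - w.1 j) - (z.1 j - w.1 j) := by abel
      have h2 := norm_sub_le ((z.2 i - w.2 i) + (w.2 i - w.1 j)) (z.1 j - w.1 j)
      have h3 := norm_add_le (z.2 i - w.2 i) (w.2 i - w.1 j)
      rw [← e] at h2
      linarith [hz1 j, hz2 i, hnot.1]
    · have e : z.1 i - z.2 j = (z.1 i - w.1 i) + (w.1 i - w.2 j) - (z.2 j - w.2 j) := by abel
      have h2 := norm_sub_le ((z.1 i - w.1 i) + (w.1 i - w.2 j)) (z.2 j - w.2 j)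
      have h3 := norm_add_le (z.1 i - w.1 i) (w.1 i - w.2 j)
      rw [← e] at h2
      linarith [hz2 j, hz1 i, hnot.2]
  rw [separation, min_eq_left]
  calc (1 : ℝ) = 2 / s * (s / 2) := by field_simp
    _ ≤ _ := mul_le_mul_of_nonneg_left h1 (by positivity)

theorem abs_separation_sub_le (hs : 0 < s) (z w : Config N × Config N) :
    |separation i s (z + w) - separation i s z| ≤ 2 / s * ‖w‖ := by
  rw [separation, separation, min_comm, min_comm (1 : ℝ)]
  refine (abs_min_sub_min_le_max _ _ _ _).trans (max_le ?_ (by simp; positivity))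
  rw [← mul_sub, abs_mul, abs_of_pos (by positivity)]
  refine mul_le_mul_of_nonneg_left ?_ (by positivity)
  have := (Metric.lipschitz_infDist_pt (unseparated i s)).dist_le_mul (z + w) z
  simpa [Real.dist_eq, dist_eq_norm] using this

theorem norm_smul_coordVec (j : Fin N) (l : Fin 3) (t : ℝ) : ‖t • coordVec j l‖ = |t| := by
  rw [norm_smul, coordVec, Pi.norm_single]
  simp

theorem continuous_selection : Continuous (selection κ a s i k) :=
  continuous_const.mul (((continuous_closeWeight.comp continuous_fst).sub continuous_const).mul
    continuous_separation)

theorem selection_sq_le (hκ : 0 ≤ κ) (ha : 0 ≤ a) (hs : 0 < s) (z : Config N × Config N) :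
    selection κ a s i k z ^ 2 ≤ 1 / 4 := by
  have h1 := one_le_closeWeight (a := a) (i := i) (k := k) hκ z.1
  have h2 := closeWeight_le (i := i) (k := k) hκ ha z.1
  have h3 := separation_nonneg (i := i) hs z
  have h4 := separation_le_one (i := i) (s := s) z
  have h5 : 0 ≤ selection κ a s i k z := by
    unfold selection
    have : 0 ≤ closeWeight κ a i k z.1 - 1 := by linarith
    positivity
  have h6 : selection κ a s i k z ≤ 1 / 2 := by
    have h7 : (closeWeight κ a i k z.1 - 1) * separation i s z ≤ Real.exp (κ * a) * 1 :=
      mul_le_mul (by linarith) h4 h3 (Real.exp_pos _).le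
    calc selection κ a s i k z ≤ Real.exp (-(κ * a)) / 2 * (Real.exp (κ * a) * 1) :=
          mul_le_mul_of_nonneg_left h7 (by positivity)
      _ = Real.exp (-(κ * a)) * Real.exp (κ * a) / 2 := by ring
      _ = 1 / 2 := by rw [← Real.exp_add, neg_add_cancel, Real.exp_zero]
  nlinarith

theorem of_selection_ne_zero {z : Config N × Config N} (h : selection κ a s i k z ≠ 0) :
    ‖z.1 i - z.1 k‖ ≤ a ∧ (∀ j, j ≠ i → s ≤ ‖z.2 i - z.1 j‖) ∧
      ∀ j, j ≠ i → s ≤ ‖z.1 i - z.2 j‖ := by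
  have hz : z ∉ unseparated i s := fun hz => h (by
    rw [selection, separation_eq_zero hz, mul_zero, mul_zero])
  refine ⟨?_, fun j hj => ?_, fun j hj => ?_⟩
  · by_contra hlt
    exact h (by rw [selection, closeWeight_eq_one (not_le.1 hlt).le, sub_self, zero_mul, mul_zero])
  · by_contra hlt
    exact hz ⟨j, hj, Or.inl (not_le.1 hlt)⟩
  · by_contra hlt
    exact hz ⟨j, hj, Or.inr (not_le.1 hlt)⟩

/-- A bound on the variation of `selection` in the direction of a coordinate of the particle `j`
of the first copy. -/
noncomputable def selectionVariation (κ a s : ℝ) (i k j : Fin N) (z : Config N × Config N) : ℝ :=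
  (Real.exp (-(κ * a)) / 2) ^ 2 *
    (4 * ((if j = i ∨ j = k then 5 / 4 * κ * closeWeight κ a i k z.1 else 0) ^ 2
      + (2 / s * (closeWeight κ a i k z.1 - 1)) ^ 2)
      + 2 * (2 / s * (closeWeight κ a i k z.2 - 1)) ^ 2)

theorem measurable_selectionVariation (j : Fin N) :
    Measurable (selectionVariation κ a s i k j) := by
  have hc : Continuous (selectionVariation κ a s i k j) := by
    unfold selectionVariation
    have h1 : Continuous fun z : Config N × Config N => closeWeight κ a i k z.1 :=
      continuous_closeWeight.comp continuous_fst
    have h2 : Continuous fun z : Config N × Config N => closeWeight κ a i k z.2 :=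
      continuous_closeWeight.comp continuous_snd
    split_ifs <;> fun_prop
  exact hc.measurable

theorem selectionVariation_nonneg (j : Fin N) (z : Config N × Config N) :
    0 ≤ selectionVariation κ a s i k j z := by
  unfold selectionVariation
  positivity

theorem selection_translate (hκ : 0 < κ) (hs : 0 < s) (hk : k ≠ i) (j : Fin N)
    (l : Fin 3) (z : Config N × Config N) {t : ℝ} (ht : |t| < 1 / (4 * κ)) :
    2 * ((selection κ a s i k (z + (t • coordVec j l, 0)) - selection κ a s i k z) ^ 2
        + (selection κ a s i k (z + (t • coordVec j l, 0)).swap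
          - selection κ a s i k z.swap) ^ 2)
      ≤ t ^ 2 * selectionVariation κ a s i k j z := by
  have hnorm : ‖((t • coordVec j l, 0) : Config N × Config N)‖ = |t| := by
    rw [Prod.norm_def, norm_smul_coordVec, norm_zero, max_eq_left (abs_nonneg t)]
  have hnorm' : ‖((0, t • coordVec j l) : Config N × Config N)‖ = |t| := by
    rw [Prod.norm_def, norm_smul_coordVec, norm_zero, max_eq_right (abs_nonneg t)]
  have hE := closeWeight_translate (a := a) hκ hk z.1 j l ht.le
  have hX := abs_separation_sub_le (i := i) hs z (t • coordVec j l, 0)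
  have hX' := abs_separation_sub_le (i := i) hs z.swap (0, t • coordVec j l)
  rw [hnorm] at hX
  rw [hnorm'] at hX'
  have hsw : (z + (t • coordVec j l, 0)).swap = z.swap + (0, t • coordVec j l) := rfl
  have h1 := one_le_closeWeight (a := a) (i := i) (k := k) hκ.le z.1
  have h2 := one_le_closeWeight (a := a) (i := i) (k := k) hκ.le z.2
  have hx0 := separation_nonneg (i := i) hs (z + (t • coordVec j l, 0))
  have hx1 := separation_le_one (i := i) (s := s) (z + (t • coordVec j l, 0))
  rw [hsw]
  simp only [selection, Prod.fst_add, Prod.fst_swap, add_zero, ← mul_sub]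
  unfold selectionVariation
  generalize Real.exp (-(κ * a)) / 2 = q
  generalize (if j = i ∨ j = k then 5 / 4 * κ * closeWeight κ a i k z.1 else 0) = A at hE ⊢
  generalize closeWeight κ a i k (z.1 + t • coordVec j l) = E' at hE ⊢
  generalize closeWeight κ a i k z.1 = E at hE h1 ⊢
  generalize closeWeight κ a i k z.2 = F at h2 ⊢
  generalize separation i s (z + (t • coordVec j l, 0)) = χ' at hX hx0 hx1 ⊢
  generalize separation i s z = χ at hX ⊢
  generalize separation i s (z.swap + (0, t • coordVec j l)) = ζ' at hX' ⊢
  generalize separation i s z.swap = ζ at hX' ⊢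
  have b1 : ((E' - E) * χ') ^ 2 ≤ t ^ 2 * A ^ 2 := by
    rw [mul_pow]
    have h3 := pow_le_pow_left₀ (abs_nonneg _) hE 2
    rw [sq_abs, mul_pow, sq_abs] at h3
    have h4 : χ' ^ 2 ≤ 1 := pow_le_one₀ hx0 hx1
    calc (E' - E) ^ 2 * χ' ^ 2 ≤ (E' - E) ^ 2 * 1 := by gcongr
      _ ≤ _ := by linarith
  have b2 : ((E - 1) * (χ' - χ)) ^ 2 ≤ t ^ 2 * (2 / s * (E - 1)) ^ 2 := by
    have h3 := pow_le_pow_left₀ (abs_nonneg _) hX 2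
    rw [sq_abs, mul_pow, sq_abs] at h3
    calc ((E - 1) * (χ' - χ)) ^ 2 = (E - 1) ^ 2 * (χ' - χ) ^ 2 := by ring
      _ ≤ (E - 1) ^ 2 * ((2 / s) ^ 2 * t ^ 2) := by gcongr
      _ = _ := by ring
  have b3 : ((F - 1) * (ζ' - ζ)) ^ 2 ≤ t ^ 2 * (2 / s * (F - 1)) ^ 2 := by
    have h3 := pow_le_pow_left₀ (abs_nonneg _) hX' 2
    rw [sq_abs, mul_pow, sq_abs] at h3
    calc ((F - 1) * (ζ' - ζ)) ^ 2 = (F - 1) ^ 2 * (ζ' - ζ) ^ 2 := by ring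
      _ ≤ (F - 1) ^ 2 * ((2 / s) ^ 2 * t ^ 2) := by gcongr
      _ = _ := by ring
  have b4 : ((E' - 1) * χ' - (E - 1) * χ) ^ 2
      ≤ 2 * (t ^ 2 * A ^ 2 + t ^ 2 * (2 / s * (E - 1)) ^ 2) := by
    have e : (E' - 1) * χ' - (E - 1) * χ = (E' - E) * χ' + (E - 1) * (χ' - χ) := by ring
    rw [e]
    nlinarith [sq_nonneg ((E' - E) * χ' - (E - 1) * (χ' - χ))]
  rw [mul_pow, mul_pow, ← mul_add]
  have hq : 0 ≤ q ^ 2 := sq_nonneg q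
  have := mul_le_mul_of_nonneg_left (add_le_add b4 b3) hq
  refine le_trans (le_of_eq (by ring)) ((mul_le_mul_of_nonneg_left this zero_le_two).trans
    (le_of_eq ?_))
  ring

end LevyLieb

namespace LevyLieb

/-! ### Exponential decay -/

variable {N : ℕ} {κ a s : ℝ} {i k : Fin N} {r : Config N → ℝ}

/-- If no particle is too concentrated, exchanges with a typical second configuration are
separated. -/
theorem half_le_lintegral_separation (hN : 2 ≤ N) (hs : 0 < s) (hk : k ≠ i) (hr : Measurable r)
    (hr1 : ∫⁻ x, ‖r x‖ₑ ^ 2 = 1)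
    (hconc : ∀ (j : Fin N) (w : Space),
      ∫⁻ y : Config N, (Metric.ball w (2 * s)).indicator 1 (y j) * ‖r y‖ₑ ^ 2
        ≤ ENNReal.ofReal (1 / (4 * ((N : ℝ) - 1)))) (x : Config N) :
    ENNReal.ofReal (1 / 2)
      ≤ ∫⁻ y : Config N, ENNReal.ofReal (separation i s (x, y) ^ 2) * ‖r y‖ₑ ^ 2 := by
  have hP : Measurable fun y => ‖r y‖ₑ ^ 2 := hr.enorm.pow_const 2
  let F : Config N → ℝ≥0∞ := fun y => ∑ j ∈ Finset.univ.erase i,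
    ((Metric.ball (x j) (2 * s)).indicator 1 (y i) * ‖r y‖ₑ ^ 2
      + (Metric.ball (x i) (2 * s)).indicator 1 (y j) * ‖r y‖ₑ ^ 2)
  have hind : ∀ (j : Fin N) (w : Space), Measurable fun y : Config N =>
      (Metric.ball w (2 * s)).indicator (1 : Space → ℝ≥0∞) (y j) * ‖r y‖ₑ ^ 2 := fun j w =>
    ((measurable_one.indicator measurableSet_ball).comp (measurable_pi_apply j)).mul hP
  have hFm : Measurable F :=
    Finset.measurable_fun_sum _ fun j _ => (hind i (x j)).add (hind j (x i))
  have hF : ∫⁻ y, F y ≤ ENNReal.ofReal (1 / 2) := by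
    have hF2 : ∀ j ∈ Finset.univ.erase i, Measurable fun y : Config N =>
        (Metric.ball (x j) (2 * s)).indicator 1 (y i) * ‖r y‖ₑ ^ 2
          + (Metric.ball (x i) (2 * s)).indicator 1 (y j) * ‖r y‖ₑ ^ 2 :=
      fun j _ => (hind i (x j)).add (hind j (x i))
    simp only [F]
    rw [lintegral_finsetSum _ hF2]
    have hN1 : (0 : ℝ) < (N : ℝ) - 1 := by
      have : (2 : ℝ) ≤ N := by exact_mod_cast hN
      linarith
    calc _ ≤ ∑ j ∈ Finset.univ.erase i, ENNReal.ofReal (1 / (2 * ((N : ℝ) - 1))) := by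
          refine Finset.sum_le_sum fun j _ => ?_
          rw [lintegral_add_left (hind i (x j))]
          refine (add_le_add (hconc i (x j)) (hconc j (x i))).trans (le_of_eq ?_)
          rw [← ENNReal.ofReal_add (by positivity) (by positivity)]
          congr 1
          field_simp
          norm_num
      _ = ENNReal.ofReal (1 / 2) := by
          rw [Finset.sum_const, Finset.card_erase_of_mem (Finset.mem_univ i), Finset.card_univ,
            Fintype.card_fin, nsmul_eq_mul, ← ENNReal.ofReal_natCast,
            ← ENNReal.ofReal_mul (by positivity), Nat.cast_sub (by omega)]
          congr 1
          push_cast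
          field_simp
  have hpt : ∀ y, ‖r y‖ₑ ^ 2 ≤ ENNReal.ofReal (separation i s (x, y) ^ 2) * ‖r y‖ₑ ^ 2 + F y := by
    intro y
    by_cases hy : (x, y) ∈ unseparated i (2 * s)
    · refine le_add_of_le_right ?_
      obtain ⟨j, hj, h⟩ := hy
      have hle := Finset.single_le_sum (f := fun j =>
        ((Metric.ball (x j) (2 * s)).indicator (1 : Space → ℝ≥0∞) (y i) * ‖r y‖ₑ ^ 2
        + (Metric.ball (x i) (2 * s)).indicator 1 (y j) * ‖r y‖ₑ ^ 2)) (fun _ _ => zero_le)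
        (Finset.mem_erase.2 ⟨hj, Finset.mem_univ j⟩)
      refine le_trans ?_ hle
      rcases h with h | h
      · have hmem : y i ∈ Metric.ball (x j) (2 * s) := by
          rwa [Metric.mem_ball, dist_eq_norm]
        simp [indicator_of_mem hmem]
      · have hmem : y j ∈ Metric.ball (x i) (2 * s) := by
          rwa [Metric.mem_ball, dist_eq_norm, norm_sub_rev]
        simp [indicator_of_mem hmem]
    · rw [separation_eq_one hs hk hy]
      simp
  have h1 : ENNReal.ofReal (1 / 2) + ENNReal.ofReal (1 / 2)
      ≤ (∫⁻ y : Config N, ENNReal.ofReal (separation i s (x, y) ^ 2) * ‖r y‖ₑ ^ 2)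
        + ENNReal.ofReal (1 / 2) := by
    calc _ = ∫⁻ y, ‖r y‖ₑ ^ 2 := by
          rw [← ENNReal.ofReal_add (by norm_num) (by norm_num), hr1]
          norm_num
      _ ≤ _ := lintegral_mono hpt
      _ = _ := lintegral_add_right _ hFm
      _ ≤ _ := by gcongr
  exact (ENNReal.add_le_add_iff_right ENNReal.ofReal_ne_top).1 h1

theorem le_lintegral_pairAmplitude_selection (hN : 2 ≤ N) (hs : 0 < s) (hk : k ≠ i)
    (hr : Measurable r) (hr1 : ∫⁻ x, ‖r x‖ₑ ^ 2 = 1)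
    (hconc : ∀ (j : Fin N) (w : Space),
      ∫⁻ y : Config N, (Metric.ball w (2 * s)).indicator 1 (y j) * ‖r y‖ₑ ^ 2
        ≤ ENNReal.ofReal (1 / (4 * ((N : ℝ) - 1)))) :
    ENNReal.ofReal ((Real.exp (-(κ * a)) / 2) ^ 2 * (1 / 2))
        * ∫⁻ x, ENNReal.ofReal ((closeWeight κ a i k x - 1) ^ 2) * ‖r x‖ₑ ^ 2
      ≤ ∫⁻ z, ‖pairAmplitude r (selection κ a s i k) z‖ₑ ^ 2 := by
  have hP : Measurable fun y => ‖r y‖ₑ ^ 2 := hr.enorm.pow_const 2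
  have hη : Measurable fun x : Config N => ENNReal.ofReal ((closeWeight κ a i k x - 1) ^ 2) :=
    ((continuous_closeWeight.measurable.sub_const 1).pow_const 2).ennreal_ofReal
  have hχ : Measurable fun z : Config N × Config N => ENNReal.ofReal (separation i s z ^ 2) :=
    (continuous_separation.measurable.pow_const 2).ennreal_ofReal
  have hG : Measurable fun z => ‖pairAmplitude r (selection κ a s i k) z‖ₑ ^ 2 :=
    (measurable_pairAmplitude hr continuous_selection.measurable).enorm.pow_const 2
  have hηP : Measurable fun x : Config N =>
      ENNReal.ofReal ((closeWeight κ a i k x - 1) ^ 2) * ‖r x‖ₑ ^ 2 := hη.mul hP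
  rw [← lintegral_const_mul _ hηP, Measure.volume_eq_prod, lintegral_prod _ hG.aemeasurable]
  refine lintegral_mono fun x => ?_
  have e : ∀ y, ‖pairAmplitude r (selection κ a s i k) (x, y)‖ₑ ^ 2
      = (ENNReal.ofReal ((Real.exp (-(κ * a)) / 2) ^ 2)
        * (ENNReal.ofReal ((closeWeight κ a i k x - 1) ^ 2) * ‖r x‖ₑ ^ 2))
        * (ENNReal.ofReal (separation i s (x, y) ^ 2) * ‖r y‖ₑ ^ 2) := by
    intro y
    simp only [pairAmplitude, selection, Real.enorm_sq_eq_ofReal_sq]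
    rw [← ENNReal.ofReal_mul (by positivity), ← ENNReal.ofReal_mul (by positivity),
      ← ENNReal.ofReal_mul (by positivity), ← ENNReal.ofReal_mul (by positivity)]
    congr 1
    ring
  simp only [e]
  have hχP : Measurable fun y : Config N =>
      ENNReal.ofReal (separation i s (x, y) ^ 2) * ‖r y‖ₑ ^ 2 :=
    (hχ.comp measurable_prodMk_left).mul hP
  rw [lintegral_const_mul _ hχP]
  refine le_trans (le_of_eq ?_)
    (mul_le_mul' le_rfl (half_le_lintegral_separation hN hs hk hr hr1 hconc x))
  rw [ENNReal.ofReal_mul (by positivity)]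
  ring

theorem sum_selectionVariation_le (hκ : 0 ≤ κ) (z : Config N × Config N) :
    ∑ j : Fin N, ∑ _l : Fin 3, selectionVariation κ a s i k j z
      ≤ (Real.exp (-(κ * a)) / 2) ^ 2 * (75 * κ ^ 2)
        + (Real.exp (-(κ * a)) / 2) ^ 2 * (75 * κ ^ 2 + 12 * N * (2 / s) ^ 2)
          * (closeWeight κ a i k z.1 - 1) ^ 2
        + (Real.exp (-(κ * a)) / 2) ^ 2 * (6 * N * (2 / s) ^ 2)
          * (closeWeight κ a i k z.2 - 1) ^ 2 := by
  have h1 := one_le_closeWeight (a := a) (i := i) (k := k) hκ z.1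
  unfold selectionVariation
  generalize Real.exp (-(κ * a)) / 2 = q
  generalize closeWeight κ a i k z.1 = E at h1 ⊢
  generalize closeWeight κ a i k z.2 = F
  have hq : 0 ≤ q ^ 2 := sq_nonneg q
  have h2 : ∑ j : Fin N, (if j = i ∨ j = k then 5 / 4 * κ * E else 0) ^ 2
      ≤ 2 * (5 / 4 * κ * E) ^ 2 := by
    calc _ ≤ ∑ j : Fin N, ((if j = i then (5 / 4 * κ * E) ^ 2 else 0)
          + (if j = k then (5 / 4 * κ * E) ^ 2 else 0)) := by
          refine Finset.sum_le_sum fun j _ => ?_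
          have := sq_nonneg (5 / 4 * κ * E)
          by_cases hi : j = i <;> by_cases hk : j = k <;> simp [hi, hk] <;> positivity
      _ = _ := by
          rw [Finset.sum_add_distrib]
          simp
          ring
  have h3 : E ^ 2 ≤ 2 * (E - 1) ^ 2 + 2 := by nlinarith [sq_nonneg (E - 2)]
  simp only [Finset.sum_const, Finset.card_univ, Fintype.card_fin, nsmul_eq_mul]
  rw [← Finset.mul_sum, ← Finset.mul_sum, Finset.sum_add_distrib, ← Finset.mul_sum,
    Finset.sum_add_distrib]
  simp only [Finset.sum_const, Finset.card_univ, Fintype.card_fin, nsmul_eq_mul]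
  have h4 : 2 * (5 / 4 * κ * E) ^ 2 ≤ 25 / 8 * κ ^ 2 * (2 * (E - 1) ^ 2 + 2) := by
    calc 2 * (5 / 4 * κ * E) ^ 2 = 25 / 8 * κ ^ 2 * E ^ 2 := by ring
      _ ≤ _ := mul_le_mul_of_nonneg_left h3 (by positivity)
  have h5 := mul_le_mul_of_nonneg_left (h2.trans h4) hq
  push_cast
  linarith

/-- The square integral of `closeWeight - 1` against the density `r ^ 2`. -/
noncomputable def closeMass (κ a : ℝ) (i k : Fin N) (r : Config N → ℝ) : ℝ≥0∞ :=
  ∫⁻ x, ENNReal.ofReal ((closeWeight κ a i k x - 1) ^ 2) * ‖r x‖ₑ ^ 2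

theorem closeMass_ne_top (hκ : 0 ≤ κ) (ha : 0 ≤ a) (hr : Measurable r)
    (hr1 : ∫⁻ x, ‖r x‖ₑ ^ 2 = 1) : closeMass κ a i k r ≠ ⊤ := by
  refine ne_top_of_le_ne_top (b := ENNReal.ofReal (Real.exp (κ * a) ^ 2) * 1)
    (ENNReal.mul_ne_top ENNReal.ofReal_ne_top ENNReal.one_ne_top) ?_
  rw [← hr1, ← lintegral_const_mul _ (hr.enorm.pow_const 2)]
  refine lintegral_mono fun x => mul_le_mul' (ENNReal.ofReal_le_ofReal ?_) le_rfl
  have h1 := one_le_closeWeight (a := a) (i := i) (k := k) hκ x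
  have h2 := closeWeight_le (i := i) (k := k) hκ ha x
  exact pow_le_pow_left₀ (by linarith) (by linarith) 2

theorem lintegral_sum_selectionVariation_le (hκ : 0 ≤ κ) (ha : 0 ≤ a) (hr : Measurable r)
    (hr1 : ∫⁻ x, ‖r x‖ₑ ^ 2 = 1) :
    ∑ j : Fin N, ∑ _l : Fin 3, ∫⁻ z : Config N × Config N,
        ENNReal.ofReal (selectionVariation κ a s i k j z) * (‖r z.1‖ₑ ^ 2 * ‖r z.2‖ₑ ^ 2)
      ≤ ENNReal.ofReal ((Real.exp (-(κ * a)) / 2) ^ 2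
        * (75 * κ ^ 2 * ((closeMass κ a i k r).toReal + 1)
          + 18 * N * (2 / s) ^ 2 * (closeMass κ a i k r).toReal)) := by
  have hP : Measurable fun y => ‖r y‖ₑ ^ 2 := hr.enorm.pow_const 2
  have hPP : Measurable fun z : Config N × Config N => ‖r z.1‖ₑ ^ 2 * ‖r z.2‖ₑ ^ 2 :=
    (hP.comp measurable_fst).mul (hP.comp measurable_snd)
  have hη : Measurable fun x : Config N => ENNReal.ofReal ((closeWeight κ a i k x - 1) ^ 2) :=
    ((continuous_closeWeight.measurable.sub_const 1).pow_const 2).ennreal_ofReal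
  have hm : ∀ j, Measurable fun z : Config N × Config N =>
      ENNReal.ofReal (selectionVariation κ a s i k j z) * (‖r z.1‖ₑ ^ 2 * ‖r z.2‖ₑ ^ 2) :=
    fun j => (measurable_selectionVariation j).ennreal_ofReal.mul hPP
  have hQ := closeMass_ne_top (i := i) (k := k) hκ ha hr hr1
  have e0 : ∫⁻ z : Config N × Config N, ‖r z.1‖ₑ ^ 2 * ‖r z.2‖ₑ ^ 2 = 1 := by
    have := lintegral_fst_mul_of_mass_one hr hr1 (V := fun _ => 1) measurable_const
    simpa [hr1] using this
  have hm1 : Measurable fun z : Config N × Config N =>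
      ENNReal.ofReal ((closeWeight κ a i k z.1 - 1) ^ 2) * (‖r z.1‖ₑ ^ 2 * ‖r z.2‖ₑ ^ 2) :=
    (hη.comp measurable_fst).mul hPP
  have hm2 : Measurable fun z : Config N × Config N =>
      ENNReal.ofReal ((closeWeight κ a i k z.2 - 1) ^ 2) * (‖r z.1‖ₑ ^ 2 * ‖r z.2‖ₑ ^ 2) :=
    (hη.comp measurable_snd).mul hPP
  have e1 := lintegral_fst_mul_of_mass_one hr hr1 hη
  have e2 : ∫⁻ z : Config N × Config N, ENNReal.ofReal ((closeWeight κ a i k z.2 - 1) ^ 2)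
      * (‖r z.1‖ₑ ^ 2 * ‖r z.2‖ₑ ^ 2) = closeMass κ a i k r := by
    have hsw : MeasurePreserving (Prod.swap : Config N × Config N → _) volume volume :=
      Measure.measurePreserving_swap
    rw [closeMass, ← e1, ← hsw.lintegral_comp hm1]
    refine lintegral_congr fun z => ?_
    simp only [Prod.fst_swap, Prod.snd_swap]
    rw [mul_comm (‖r z.2‖ₑ ^ 2)]
  change _ = closeMass κ a i k r at e1
  have hsum : ∑ j : Fin N, ∑ _l : Fin 3, ∫⁻ z : Config N × Config N,
        ENNReal.ofReal (selectionVariation κ a s i k j z) * (‖r z.1‖ₑ ^ 2 * ‖r z.2‖ₑ ^ 2)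
      = ∫⁻ z : Config N × Config N,
        ENNReal.ofReal (∑ j : Fin N, ∑ _l : Fin 3, selectionVariation κ a s i k j z)
          * (‖r z.1‖ₑ ^ 2 * ‖r z.2‖ₑ ^ 2) := by
    have h3 : ∀ z : Config N × Config N,
        ENNReal.ofReal (∑ j : Fin N, ∑ _l : Fin 3, selectionVariation κ a s i k j z)
          * (‖r z.1‖ₑ ^ 2 * ‖r z.2‖ₑ ^ 2)
        = ∑ j : Fin N, ∑ _l : Fin 3, ENNReal.ofReal (selectionVariation κ a s i k j z)
          * (‖r z.1‖ₑ ^ 2 * ‖r z.2‖ₑ ^ 2) := fun z => by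
      rw [ENNReal.ofReal_sum_of_nonneg fun j _ => Finset.sum_nonneg fun l _ =>
        selectionVariation_nonneg j z, Finset.sum_mul]
      refine Finset.sum_congr rfl fun j _ => ?_
      rw [ENNReal.ofReal_sum_of_nonneg fun l _ => selectionVariation_nonneg j z, Finset.sum_mul]
    simp only [h3]
    rw [lintegral_finsetSum _ fun j _ => Finset.measurable_fun_sum _ fun l _ => hm j]
    exact Finset.sum_congr rfl fun j _ => (lintegral_finsetSum _ fun l _ => hm j).symm
  rw [hsum]
  set c0 := (Real.exp (-(κ * a)) / 2) ^ 2 * (75 * κ ^ 2) with hc0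
  set c1 := (Real.exp (-(κ * a)) / 2) ^ 2 * (75 * κ ^ 2 + 12 * N * (2 / s) ^ 2) with hc1
  set c2 := (Real.exp (-(κ * a)) / 2) ^ 2 * (6 * N * (2 / s) ^ 2) with hc2
  calc _ ≤ ∫⁻ z : Config N × Config N, (ENNReal.ofReal c0 * (‖r z.1‖ₑ ^ 2 * ‖r z.2‖ₑ ^ 2)
        + ENNReal.ofReal c1 * (ENNReal.ofReal ((closeWeight κ a i k z.1 - 1) ^ 2)
          * (‖r z.1‖ₑ ^ 2 * ‖r z.2‖ₑ ^ 2))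
        + ENNReal.ofReal c2 * (ENNReal.ofReal ((closeWeight κ a i k z.2 - 1) ^ 2)
          * (‖r z.1‖ₑ ^ 2 * ‖r z.2‖ₑ ^ 2))) := by
        refine lintegral_mono fun z => ?_
        simp only
        generalize ‖r z.1‖ₑ ^ 2 * ‖r z.2‖ₑ ^ 2 = p
        rw [← mul_assoc, ← mul_assoc, ← add_mul, ← add_mul, ← ENNReal.ofReal_mul (by positivity),
          ← ENNReal.ofReal_mul (by positivity),
          ← ENNReal.ofReal_add (by positivity) (by positivity),
          ← ENNReal.ofReal_add (by positivity) (by positivity)]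
        exact mul_le_mul' (ENNReal.ofReal_le_ofReal (sum_selectionVariation_le hκ z)) le_rfl
    _ = ENNReal.ofReal c0 * 1 + ENNReal.ofReal c1 * closeMass κ a i k r
        + ENNReal.ofReal c2 * closeMass κ a i k r := by
        rw [lintegral_add_right _ (hm2.const_mul _), lintegral_add_right _ (hm1.const_mul _),
          lintegral_const_mul _ hPP, lintegral_const_mul _ hm1, lintegral_const_mul _ hm2,
          e0, e1, e2]
    _ = _ := by
        conv_lhs => rw [← ENNReal.ofReal_toReal hQ]
        rw [mul_one, ← ENNReal.ofReal_mul (by positivity), ← ENNReal.ofReal_mul (by positivity),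
          ← ENNReal.ofReal_add (by positivity) (by positivity),
          ← ENNReal.ofReal_add (by positivity) (by positivity)]
        congr 1
        rw [hc0, hc1, hc2]
        ring

end LevyLieb

namespace LevyLieb

variable {N : ℕ}

/-- The exponential weight is square integrable with a universal bound, if its rate is at most
`√(m / (512 ε))`: the kinetic energy of the weight is then dominated by the interaction energy
that is gained in the exchange. -/
theorem IsMinimizer.closeMass_le_one {c : Space → Space → ℝ≥0∞} {m M : ℝ → ℝ}
    (h : IsRepulsiveCost c m M) (hN : 2 ≤ N) {ρ : Measure Space} {ε : ℝ} (hε : 0 < ε)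
    {ψ : Config N → ℂ} (hmin : IsMinimizer ε c ρ ψ) {r : Config N → ℝ} (hr : Measurable r)
    (hrψ : ∀ᵐ x, r x = ‖ψ x‖) (hr1 : ∫⁻ x, ‖r x‖ₑ ^ 2 = 1) {s a κ : ℝ} (hs : 0 < s) (ha : 0 < a)
    (hκ : 0 < κ) {i k : Fin N} (hk : k ≠ i)
    (hconc : ∀ (j : Fin N) (w : Space),
      ∫⁻ y : Config N, (Metric.ball w (2 * s)).indicator 1 (y j) * ‖r y‖ₑ ^ 2
        ≤ ENNReal.ofReal (1 / (4 * ((N : ℝ) - 1))))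
    (hm : 0 < m a) (hM : 8 * ((N : ℝ) - 1) * M s ≤ m a) (hκm : 512 * ε * κ ^ 2 ≤ m a)
    (hNs : 1000 * (ε * N * (2 / s) ^ 2) ≤ m a) :
    (closeMass κ a i k r).toReal ≤ 1 := by
  have hW := lintegral_sum_selectionVariation_le (i := i) (k := k) (s := s) hκ.le ha.le hr hr1
  have hWt : ∀ j, ∫⁻ z : Config N × Config N,
      ENNReal.ofReal (selectionVariation κ a s i k j z) * (‖r z.1‖ₑ ^ 2 * ‖r z.2‖ₑ ^ 2) ≠ ⊤ := by
    intro j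
    refine ne_top_of_le_ne_top (ne_top_of_le_ne_top ENNReal.ofReal_ne_top hW) ?_
    refine le_trans ?_ (Finset.single_le_sum (f := fun j : Fin N => ∑ _l : Fin 3,
      ∫⁻ z : Config N × Config N, ENNReal.ofReal (selectionVariation κ a s i k j z)
        * (‖r z.1‖ₑ ^ 2 * ‖r z.2‖ₑ ^ 2)) (fun _ _ => zero_le) (Finset.mem_univ j))
    exact Finset.single_le_sum (f := fun _ : Fin 3 =>
      ∫⁻ z : Config N × Config N, ENNReal.ofReal (selectionVariation κ a s i k j z)
        * (‖r z.1‖ₑ ^ 2 * ‖r z.2‖ₑ ^ 2)) (fun _ _ => zero_le) (Finset.mem_univ 0)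
  have hex := hmin.exchange_le h hr hrψ hr1 (d := a) hs hk
    continuous_selection.measurable (selection_sq_le (i := i) (k := k) hκ.le ha.le hs)
    (fun z hz => of_selection_ne_zero hz) measurable_selectionVariation
    selectionVariation_nonneg hWt (δ := 1 / (4 * κ)) (by positivity)
    (fun j l z t ht => selection_translate hκ hs hk j l z ht)
  have hlow := le_lintegral_pairAmplitude_selection (κ := κ) (a := a) hN hs hk hr hr1 hconc
  have hg := lintegral_pairAmplitude_ne_top hr hr1
    (selection_sq_le (i := i) (k := k) hκ.le ha.le hs)
  have hQ := closeMass_ne_top (i := i) (k := k) hκ.le ha.le hr hr1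
  change _ * closeMass κ a i k r ≤ _ at hlow
  replace hex := hex.trans (add_le_add (mul_le_mul' le_rfl hW) le_rfl)
  have hq0 : 0 ≤ (closeMass κ a i k r).toReal := ENNReal.toReal_nonneg
  rw [← ENNReal.ofReal_toReal hQ] at hlow
  generalize (closeMass κ a i k r).toReal = q at hex hlow hq0 ⊢
  rw [← ENNReal.ofReal_toReal hg] at hex hlow
  have hg0 : 0 ≤ (∫⁻ z, ‖pairAmplitude r (selection κ a s i k) z‖ₑ ^ 2).toReal :=
    ENNReal.toReal_nonneg
  generalize (∫⁻ z, ‖pairAmplitude r (selection κ a s i k) z‖ₑ ^ 2).toReal = g at hex hlow hg0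
  have hL : 0 < (Real.exp (-(κ * a)) / 2) ^ 2 := by positivity
  generalize (Real.exp (-(κ * a)) / 2) ^ 2 = L at hex hlow hL
  have hM0 : 0 ≤ M s := h.upper_nonneg s hs
  have hNR : (2 : ℝ) ≤ N := by exact_mod_cast hN
  -- the inequalities between real numbers
  rw [← ENNReal.ofReal_mul (by positivity), ENNReal.ofReal_le_ofReal_iff hg0] at hlow
  have hnat : ((N - 1 : ℕ) : ℝ≥0∞) = ENNReal.ofReal ((N : ℝ) - 1) := by
    rw [← ENNReal.ofReal_natCast, Nat.cast_sub (by omega), Nat.cast_one]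
  have h2 : (2 : ℝ≥0∞) = ENNReal.ofReal 2 := by norm_num
  have h4 : (4 : ℝ≥0∞) = ENNReal.ofReal 4 := by norm_num
  have hN1 : 0 ≤ (N : ℝ) - 1 := by linarith
  rw [hnat, h2, h4, ← ENNReal.ofReal_mul (by positivity), ← ENNReal.ofReal_mul (by positivity),
    ← ENNReal.ofReal_mul (by positivity), ← ENNReal.ofReal_mul (by positivity),
    ← ENNReal.ofReal_mul (by positivity), ← ENNReal.ofReal_mul (by positivity),
    ← ENNReal.ofReal_mul (by positivity), ← ENNReal.ofReal_add (by positivity) (by positivity),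
    ENNReal.ofReal_le_ofReal_iff (by positivity)] at hex
  have hMg : 4 * ((N : ℝ) - 1) * M s * g ≤ m a / 2 * g :=
    mul_le_mul_of_nonneg_right (by linarith) hg0
  have h5 : 3 / 2 * m a * (L * (1 / 2) * q)
      ≤ 2 * ε * (L * (75 * κ ^ 2 * (q + 1) + 18 * N * (2 / s) ^ 2 * q)) := by
    have h6 := mul_le_mul_of_nonneg_left hlow (by positivity : 0 ≤ 3 / 2 * m a)
    linarith
  have h7 : 3 / 4 * m a * q ≤ 150 * (ε * κ ^ 2) * (q + 1) + 36 * (ε * N * (2 / s) ^ 2) * q := by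
    refine le_of_mul_le_mul_left ?_ hL
    linarith
  have h8 : 150 * (ε * κ ^ 2) * (q + 1) ≤ 150 / 512 * m a * (q + 1) :=
    mul_le_mul_of_nonneg_right (by linarith) (by linarith)
  have h9 : 36 * (ε * N * (2 / s) ^ 2) * q ≤ 36 / 1000 * m a * q :=
    mul_le_mul_of_nonneg_right (by linarith) hq0
  refine le_of_mul_le_mul_left ?_ hm
  have h10 : 0 ≤ m a * q := by positivity
  linarith

/-- A Chebyshev inequality: on the event that the particles `i` and `k` are at distance at most
half the range of the weight, the weight is exponentially large. -/
theorem lintegral_close_le {κ α : ℝ} {i k : Fin N} {r : Config N → ℝ}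
    (hκα : 1 ≤ κ * α) (hκ : 0 ≤ κ)
    (hQt : closeMass κ (2 * α) i k r ≠ ⊤) (hQ : (closeMass κ (2 * α) i k r).toReal ≤ 1) :
    ∫⁻ x in {x : Config N | ‖x i - x k‖ ≤ α}, ‖r x‖ₑ ^ 2
      ≤ ENNReal.ofReal (4 * Real.exp (-(2 * (κ * α)))) := by
  have hS : MeasurableSet {x : Config N | ‖x i - x k‖ ≤ α} :=
    (isClosed_le (by fun_prop) continuous_const).measurableSet
  have hQ1 : closeMass κ (2 * α) i k r ≤ 1 := by
    rw [← ENNReal.ofReal_toReal hQt, ← ENNReal.ofReal_one]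
    exact ENNReal.ofReal_le_ofReal hQ
  rw [← lintegral_indicator hS]
  refine le_trans ?_ ((mul_le_mul' le_rfl hQ1).trans (mul_one _).le)
  rw [closeMass]
  rw [← lintegral_const_mul' _ _ ENNReal.ofReal_ne_top]
  refine lintegral_mono fun x => ?_
  by_cases hx : ‖x i - x k‖ ≤ α
  · rw [indicator_of_mem (show x ∈ {x : Config N | ‖x i - x k‖ ≤ α} from hx), ← mul_assoc,
      ← ENNReal.ofReal_mul (by positivity)]
    refine le_mul_of_one_le_left zero_le ?_
    rw [← ENNReal.ofReal_one]
    refine ENNReal.ofReal_le_ofReal ?_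
    have h1 : Real.exp (κ * α) ≤ closeWeight κ (2 * α) i k x := by
      refine Real.exp_le_exp.2 (mul_le_mul_of_nonneg_left ?_ hκ)
      exact le_trans (by linarith) (le_max_right _ _)
    have h2 : 2 ≤ Real.exp (κ * α) := by
      have := Real.add_one_le_exp (κ * α)
      linarith
    have h3 : Real.exp (κ * α) / 2 ≤ closeWeight κ (2 * α) i k x - 1 := by linarith
    have h4 : (Real.exp (κ * α) / 2) ^ 2 ≤ (closeWeight κ (2 * α) i k x - 1) ^ 2 :=
      pow_le_pow_left₀ (by positivity) h3 2
    calc (1 : ℝ) = 4 * Real.exp (-(2 * (κ * α))) * (Real.exp (κ * α) / 2) ^ 2 := by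
          have : Real.exp (-(2 * (κ * α))) * Real.exp (κ * α) ^ 2 = 1 := by
            rw [← Real.exp_nat_mul, ← Real.exp_add]
            push_cast
            rw [neg_add_cancel, Real.exp_zero]
          linear_combination -this
      _ ≤ _ := mul_le_mul_of_nonneg_left h4 (by positivity)
  · rw [indicator_of_notMem (show x ∉ {x : Config N | ‖x i - x k‖ ≤ α} from hx)]
    exact zero_le

end LevyLieb

open LevyLieb in
/-- The constant `K` makes `ε N² ≪ α² m(2α)` precise; it is universal. -/
theorem theorem1p2 :
    ∃ K : ℝ, 0 < K ∧
      ∀ (N : ℕ) (_ : 2 ≤ N)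
        (c : LevyLieb.Space → LevyLieb.Space → ℝ≥0∞) (m M : ℝ → ℝ)
        (_ : LevyLieb.IsRepulsiveCost c m M)
        (ρ : Measure LevyLieb.Space) (_ : ρ univ = N)
        (ε : ℝ) (_ : 0 < ε)
        (ψ : LevyLieb.Config N → ℂ) (_ : LevyLieb.IsMinimizer ε c ρ ψ)
        (β : ℝ) (_ : 0 < β)
        (_ : LevyLieb.concentration N ρ β ≤ ENNReal.ofReal (1 / (4 * ((N : ℝ) - 1))))
        (α : ℝ) (_ : 0 < α)
        (_ : 8 * ((N : ℝ) - 1) * M (β / 2) ≤ m (2 * α))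
        (_ : K * (ε * (N : ℝ) ^ 2) ≤ α ^ 2 * m (2 * α)),
        ∫ x in LevyLieb.enlargedDiagonal N α, ‖ψ x‖ ^ 2
          ≤ Real.exp (-(1 / 6) * √(α ^ 2 * m (2 * α) / (8 * ε))) := by
  -- this choice makes the decay exponent `√(α ^ 2 * m (2 * α) / (8 * ε))` at least `48 * N`
  refine ⟨8 * 48 ^ 2, by norm_num, ?_⟩
  intro N hN c m M hc ρ hρ ε hε ψ hψ β hβ hκ α hα hM hK
  have hNR : (2 : ℝ) ≤ N := by exact_mod_cast hN
  have hψm : AEStronglyMeasurable ψ volume := hψ.1.1.1.1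
  have hm : 0 < m (2 * α) := by
    have h1 : 0 < α ^ 2 * m (2 * α) := lt_of_lt_of_le (by positivity) hK
    exact pos_of_mul_pos_right h1 (by positivity)
  -- `m (2 * α)` dominates `M (β / 2) ≥ m (β / 2)`, so that `2 * α < β / 2` by monotonicity
  have hαβ : 2 * α < β / 2 := by
    by_contra hcon
    have hβ2 : (0 : ℝ) < β / 2 := by linarith
    have h1 : m (2 * α) ≤ m (β / 2) :=
      hc.lower_antitone hβ2 (by simpa using hα) (not_lt.1 hcon)
    have h2 : m (β / 2) ≤ M (β / 2) := by
      have hn : ‖(EuclideanSpace.single 0 (β / 2) : Space) - 0‖ = β / 2 := by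
        rw [sub_zero, PiLp.norm_single, Real.norm_eq_abs, abs_of_pos hβ2]
      have hne : (EuclideanSpace.single 0 (β / 2) : Space) ≠ 0 := by
        rw [← sub_ne_zero, ← norm_ne_zero_iff, hn]
        exact hβ2.ne'
      have h3 := (hc.lower_le _ _ hne).trans (hc.le_upper _ _ hne)
      rw [hn] at h3
      exact (ENNReal.ofReal_le_ofReal_iff (hc.upper_nonneg _ hβ2)).1 h3
    nlinarith [hc.upper_nonneg _ hβ2]
  -- a measurable representative of `‖ψ‖`
  set r : Config N → ℝ := fun x => ‖hψm.mk ψ x‖ with hrdef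
  have hr : Measurable r := hψm.stronglyMeasurable_mk.measurable.norm
  have hrψ : ∀ᵐ x, r x = ‖ψ x‖ := hψm.ae_eq_mk.mono fun x hx => by simp only [hrdef, hx]
  have hsq : ∀ᵐ x, ‖ψ x‖ₑ ^ 2 = ‖r x‖ₑ ^ 2 := hrψ.mono fun x hx => by rw [hx, enorm_norm]
  have hN0 : (N : ℝ≥0∞) ≠ 0 := by exact_mod_cast (by omega : N ≠ 0)
  have hmarg : ∀ (j : Fin N) (S : Set Space), MeasurableSet S →
      (N : ℝ≥0∞) * ∫⁻ x : Config N, S.indicator 1 (x j) * ‖r x‖ₑ ^ 2 = ρ S := fun j S hS => by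
    rw [← hasDensity_iff.1 hψ.1.2.2 j S hS]
    congr 1
    exact lintegral_congr_ae (hsq.mono fun x hx => by simp only [hx])
  have hr1 : ∫⁻ x, ‖r x‖ₑ ^ 2 = 1 := by
    have h1 := hmarg ⟨0, by omega⟩ univ MeasurableSet.univ
    simp only [indicator_univ, Pi.one_apply, one_mul, hρ] at h1
    rw [← ENNReal.mul_right_inj hN0 (ENNReal.natCast_ne_top N), h1, mul_one]
  have hconc : ∀ (j : Fin N) (w : Space),
      ∫⁻ y : Config N, (Metric.ball w (2 * (β / 2))).indicator 1 (y j) * ‖r y‖ₑ ^ 2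
        ≤ ENNReal.ofReal (1 / (4 * ((N : ℝ) - 1))) := fun j w => by
    refine le_trans (le_of_eq ?_) ((le_iSup (fun x => ρ (Metric.ball x β) / N) w).trans hκ)
    rw [← hmarg j _ measurableSet_ball, mul_div_cancel₀ β two_ne_zero, mul_comm,
      mul_div_assoc, ENNReal.div_self hN0 (ENNReal.natCast_ne_top N), mul_one]
  -- The weight is taken with rate `σ / (8 * α)`. It gives each pair of particles the bound
  -- `4 * exp (-σ / 4)`, and the gap between `σ / 4` and `σ / 6` absorbs the number of pairs.
  set σ := √(α ^ 2 * m (2 * α) / (8 * ε)) with hσ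
  have hσ2 : σ ^ 2 = α ^ 2 * m (2 * α) / (8 * ε) := Real.sq_sqrt (by positivity)
  have hσN : 48 * N ≤ σ := by
    refine Real.le_sqrt_of_sq_le ?_
    rw [le_div_iff₀ (by positivity)]
    linarith
  have hσ0 : 0 < σ := by linarith
  have hrate : σ / (8 * α) * α = σ / 8 := by field_simp
  have hpair : ∀ i k : Fin N, k ≠ i → ∫⁻ x in {x : Config N | ‖x i - x k‖ ≤ α}, ‖r x‖ₑ ^ 2
      ≤ ENNReal.ofReal (4 * Real.exp (-(σ / 4))) := by
    intro i k hk
    have hQ := hψ.closeMass_le_one hc hN hε hr hrψ hr1 (s := β / 2) (a := 2 * α)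
      (κ := σ / (8 * α)) (by positivity) (by positivity) (by positivity) hk hconc hm hM
      (by
        rw [div_pow, hσ2]
        refine le_of_eq ?_
        field_simp
        ring)
      (by
        have h1 : (2 / (β / 2)) ^ 2 ≤ 1 / α ^ 2 := by
          rw [div_pow, div_le_div_iff₀ (by positivity) (by positivity)]
          nlinarith
        calc 1000 * (ε * N * (2 / (β / 2)) ^ 2) ≤ 1000 * (ε * N * (1 / α ^ 2)) := by gcongr
          _ = 1000 * (ε * N) / α ^ 2 := by ring
          _ ≤ m (2 * α) := by
              rw [div_le_iff₀ (by positivity)]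
              have h2 : ε * N ≤ ε * (N : ℝ) ^ 2 :=
                mul_le_mul_of_nonneg_left (by nlinarith) hε.le
              have h3 : 0 ≤ ε * N := by positivity
              linarith)
    have h := lintegral_close_le (by rw [hrate]; linarith) (by positivity)
      (closeMass_ne_top (by positivity) (by positivity) hr hr1) hQ
    rw [hrate] at h
    refine h.trans (le_of_eq ?_)
    congr 3
    ring
  -- the union bound over the pairs of particles
  have hD : ∫⁻ x in enlargedDiagonal N α, ENNReal.ofReal (‖ψ x‖ ^ 2)
      ≤ ENNReal.ofReal (Real.exp (-(1 / 6) * σ)) := by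
    have hsub : enlargedDiagonal N α ⊆ ⋃ p : {p : Fin N × Fin N // p.2 ≠ p.1},
        {x : Config N | ‖x p.1.1 - x p.1.2‖ ≤ α} := by
      rintro x ⟨i, j, hij, hx⟩
      exact mem_iUnion.2 ⟨⟨(i, j), hij.symm⟩, hx⟩
    calc _ = ∫⁻ x in enlargedDiagonal N α, ‖r x‖ₑ ^ 2 := by
          refine lintegral_congr_ae (ae_restrict_of_ae (hrψ.mono fun x hx => ?_))
          simp only [Real.enorm_sq_eq_ofReal_sq, hx]
      _ ≤ ∫⁻ x in ⋃ p : {p : Fin N × Fin N // p.2 ≠ p.1},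
          {x : Config N | ‖x p.1.1 - x p.1.2‖ ≤ α}, ‖r x‖ₑ ^ 2 := lintegral_mono_set hsub
      _ ≤ ∑' p : {p : Fin N × Fin N // p.2 ≠ p.1},
          ∫⁻ x in {x : Config N | ‖x p.1.1 - x p.1.2‖ ≤ α}, ‖r x‖ₑ ^ 2 := lintegral_iUnion_le _ _
      _ ≤ ∑ _p : {p : Fin N × Fin N // p.2 ≠ p.1}, ENNReal.ofReal (4 * Real.exp (-(σ / 4))) := by
          rw [tsum_fintype]
          exact Finset.sum_le_sum fun p _ => hpair _ _ p.2
      _ ≤ (N ^ 2 : ℕ) * ENNReal.ofReal (4 * Real.exp (-(σ / 4))) := by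
          rw [Finset.sum_const, nsmul_eq_mul]
          gcongr
          refine (Fintype.card_subtype_le _).trans (le_of_eq ?_)
          rw [Fintype.card_prod, Fintype.card_fin, sq]
      _ ≤ _ := by
          rw [← ENNReal.ofReal_natCast, ← ENNReal.ofReal_mul (by positivity)]
          refine ENNReal.ofReal_le_ofReal ?_
          have h1 : (2 * N : ℝ) ≤ Real.exp (σ / 24) :=
            le_trans (by linarith) (Real.add_one_le_exp _)
          have h2 : (2 * N : ℝ) ^ 2 ≤ Real.exp (σ / 12) := by
            refine (pow_le_pow_left₀ (by positivity) h1 2).trans (le_of_eq ?_)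
            rw [← Real.exp_nat_mul]
            congr 1
            push_cast
            ring
          calc ((N ^ 2 : ℕ) : ℝ) * (4 * Real.exp (-(σ / 4)))
              = (2 * N : ℝ) ^ 2 * Real.exp (-(σ / 4)) := by push_cast; ring
            _ ≤ Real.exp (σ / 12) * Real.exp (-(σ / 4)) := by gcongr
            _ = Real.exp (-(1 / 6) * σ) := by
                rw [← Real.exp_add]
                congr 1
                ring
  have hsqm : AEStronglyMeasurable (fun x => ‖ψ x‖ ^ 2)
      (volume.restrict (enlargedDiagonal N α)) := (hψm.norm.pow 2).restrict
  rw [integral_eq_lintegral_of_nonneg_ae (Eventually.of_forall fun x => by positivity) hsqm]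
  exact ENNReal.toReal_le_of_le_ofReal (Real.exp_pos _).le hD
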